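/- Let $d\ge 1$, let $X_1,X_2,\ldots$ be independent, identically distributed random vectors in $\mathbb{R}^d$ whose common distribution $\mu$ has a density with respect to Lebesgue measure. Let $\|\cdot\|$ be the Euclidean norm, let $S(x,r)=\{y\in\mathbb{R}^d:\|y-x\|\le r\}$ be the closed ball with centre $x$ and radius $r$, and let $\mathrm{supp}(\mu)=\{x\in\mathbb{R}^d:\mu(S(x,r))>0\text{ for each }r>0\}$. For $n\ge 2$ put $R_{i,n}=\min_{j\ne i,\,1\le j\le n}\|X_i-X_j\|$ and $P_n=\max_{1\le i\le n}\mu(S(X_i,R_{i,n}))$. Assume that there are $\beta\in(0,1)$, $c_{\max}<\infty$ and $\delta>0$ such that, for all $r,s>0$ and all $x,z\in\mathrm{supp}(\mu)$ with $\|x-z\|\ge\max\{r,s\}$ and $\mu(S(x,r))=\mu(S(z,s))\le\delta$, one has $$\frac{\mu(S(x,r)\cap S(z,s))}{\mu(S(z,s))}\le\beta\qquad\text{and}\qquad \mu(S(z,2s))\le c_{\max}\,\mu(S(z,s)).$$ Then, for every $y\in\mathbb{R}$, as $n\to\infty$, the random variable $$\sum_{i=1}^n \mathbf{1}\{n\,\mu(S(X_i,R_{i,n}))>y+\ln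 n\}$$ converges in distribution to the Poisson distribution with parameter $e^{-y}$, and hence $$\lim_{n\to\infty}\mathbb{P}(nP_n-\ln n\le y)=\exp(-\exp(-y)),\qquad y\in\mathbb{R}.$$ -/

import Mathlib

open MeasureTheory ProbabilityTheory Filter Topology

noncomputable section

/-- Nearest neighbour distance of the point `x i` within the configuration `x 0, …, x (n - 1)`:
the minimum of `‖x i - x j‖` over all `j ≠ i` (it is a genuine minimum as soon as `2 ≤ n`). -/
def nnRadius {d n : ℕ} (x : Fin n → EuclideanSpace ℝ (Fin d)) (i : Fin n) : ℝ :=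
  ⨅ j : {j : Fin n // j ≠ i}, ‖x i - x j‖

/-- The `μ`-probability of the closed nearest neighbour ball centred at `x i`. -/
def nnBallProb {d n : ℕ} (μ : Measure (EuclideanSpace ℝ (Fin d)))
    (x : Fin n → EuclideanSpace ℝ (Fin d)) (i : Fin n) : ℝ :=
  μ.real (Metric.closedBall (x i) (nnRadius x i))

/-- The maximum `μ`-probability of the nearest neighbour balls of a configuration. -/
def maxNNBallProb {d n : ℕ} (μ : Measure (EuclideanSpace ℝ (Fin d)))
    (x : Fin n → EuclideanSpace ℝ (Fin d)) : ℝ :=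
  ⨆ i : Fin n, nnBallProb μ x i

/-- The number of `i` such that `n` times the `μ`-probability of the nearest neighbour ball centred
at `x i` is larger than `y + ln n`, written as a sum of indicators. -/
def nnExceedances {d n : ℕ} (μ : Measure (EuclideanSpace ℝ (Fin d))) (y : ℝ)
    (x : Fin n → EuclideanSpace ℝ (Fin d)) : ℕ :=
  ∑ i : Fin n, Set.indicator (Set.Ioi (y + Real.log n)) (fun _ => 1) ((n : ℝ) * nnBallProb μ x i)

end

/-!
Write `t = (y + ln n) / n`. Spheres are `μ`-null, so every point `x` has a ball of `μ`-probability
exactly `t`; let `ρ x` be the largest radius of such a ball (`quantileRadius`). The nearest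
neighbour ball of `x i` has probability larger than `t` if and only if all other points have
distance larger than `ρ (x i)` from `x i`. By the method of binomial moments (`tendsto_of_bonferroni`),
it suffices that for every `k` the probability that `k` given points are isolated in this sense is asymptotic to
`(e⁻ʸ / n) ^ k`.

Given the `k` points, the remaining `n - k` points independently have to avoid the union of the `k`
balls (`measure_forall_isolated`). This union has probability at most `k t`, and the `k` points are
not too close to each other with probability at least `1 - k² t`, which gives the lower bound. If
the balls are disjoint, the union has probability `k t`, which gives the main term
`exp (-k t (n - k))` of the upper bound.

It remains to see that overlapping balls do not contribute. If the balls of `a` and `b` overlap,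
choose a maximal subfamily `I` of the `k` balls that contains these two and has no other overlaps
(`exists_maximal_unlinked`). By the overlap condition, `I` covers probability at least
`(|I| - β) t`. Each ball outside `I` overlaps one of `I`, so `k + 1 - |I|` overlaps occur, each of
conditional probability `O(t)` (`lintegral_linked_mul_prod_le`). The total contribution is
`n ^ k t ^ (k + 1 - |I|) exp (-(|I| - β) t n)`, which is `n ^ (β - 1)` up to powers of `ln n`.

The bound `O(t)` for an overlap with the ball of a fixed point `z` (`measure_linked_le`)
distinguishes which of the two balls is larger. If it is the ball of `z`, the other centre lies in
the doubled ball of `z`, and the doubling condition applies. Otherwise `z` lies in a ball of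
probability `O(t)` around the other centre, and the set of such centres has probability `O(t)`
because the space is a union of finitely many narrow cones with apex `z`
(`exists_measure_closedBall_le_le`).
-/

/-! ### Narrow cones and quantile radii -/

section Balls

variable {E : Type*} [NormedAddCommGroup E]

section Cones

variable [NormedSpace ℝ E]

/-- Two points of a narrow cone with apex `z` are no further apart than the more distant one of them
is from `z`. -/
lemma dist_le_dist_apex_of_mem_cone {z u x w : E}
    (hx : ‖(x - z) - ‖x - z‖ • u‖ ≤ ‖x - z‖ / 2) (hw : ‖(w - z) - ‖w - z‖ • u‖ ≤ ‖w - z‖ / 2)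
    (hwx : ‖w - z‖ ≤ ‖x - z‖) : ‖w - x‖ ≤ ‖x - z‖ := by
  have e : w - x = (w - z) - (x - z) := by abel
  rw [e]
  generalize w - z = b at *
  generalize x - z = a at *
  rcases eq_or_lt_of_le (norm_nonneg a) with h0 | h0
  · have ha : a = 0 := norm_eq_zero.1 h0.symm
    subst ha
    simpa using hwx
  set q := ‖b‖ / ‖a‖ with hq
  have hq0 : 0 ≤ q := by positivity
  have hq1 : q ≤ 1 := div_le_one_of_le₀ hwx h0.le
  have hqa : q * ‖a‖ = ‖b‖ := by rw [hq]; field_simp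
  -- Compare `b` with the point `q • a` at distance `‖b‖` from the apex on the ray through `a`.
  have h1 : b - a = (b - ‖b‖ • u) - q • (a - ‖a‖ • u) - (1 - q) • a := by
    rw [smul_sub, smul_smul, hqa]; module
  calc ‖b - a‖ ≤ ‖b - ‖b‖ • u‖ + ‖q • (a - ‖a‖ • u)‖ + ‖(1 - q) • a‖ := by
        rw [h1]; exact (norm_sub_le _ _).trans (by gcongr; exact norm_sub_le _ _)
    _ ≤ ‖b‖ / 2 + q * (‖a‖ / 2) + (1 - q) * ‖a‖ := by
        rw [norm_smul, norm_smul, Real.norm_of_nonneg hq0, Real.norm_of_nonneg (by linarith)]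
        gcongr
    _ = ‖a‖ := by linear_combination (-1 / 2) * hqa

variable (E) in
/-- A finite-dimensional space is covered by finitely many narrow cones with a given apex. -/
lemma exists_finset_cones [ProperSpace E] : ∃ T : Finset E, ∀ v : E, ∃ u ∈ T,
    ‖v - ‖v‖ • u‖ ≤ ‖v‖ / 2 := by
  obtain ⟨T, hTs, hT, hcov⟩ := (isCompact_closedBall (0 : E) 1).finite_cover_balls
    (e := 1 / 2) (by norm_num)
  refine ⟨hT.toFinset, fun v => ?_⟩
  have hv : ‖v‖⁻¹ • v ∈ Metric.closedBall (0 : E) 1 := by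
    rw [mem_closedBall_zero_iff, norm_smul, norm_inv, norm_norm]
    exact inv_mul_le_one
  obtain ⟨u, hu, hvu⟩ := Set.mem_iUnion₂.1 (hcov hv)
  refine ⟨u, by simpa using hu, ?_⟩
  rcases eq_or_ne v 0 with rfl | hv0
  · simp
  have hn : ‖v‖ ≠ 0 := norm_ne_zero_iff.2 hv0
  have : v - ‖v‖ • u = ‖v‖ • (‖v‖⁻¹ • v - u) := by
    rw [smul_sub, smul_smul, mul_inv_cancel₀ hn, one_smul]
  rw [this, norm_smul, norm_norm]
  rw [Metric.mem_ball, dist_eq_norm] at hvu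
  nlinarith [norm_nonneg v]

end Cones

variable [MeasurableSpace E]

/-- The `t`-quantile of the distance to `x` under `μ`: the largest `r` such that the closed ball of
radius `r` around `x` has `μ`-probability at most `t` (meaningful for `0 < t < 1`). -/
noncomputable def quantileRadius (μ : Measure E) (t : ℝ) (x : E) : ℝ :=
  sSup {r | μ.real (Metric.closedBall x r) ≤ t}

section QuantileRadius

variable {μ : Measure E} [IsProbabilityMeasure μ]

lemma measureReal_closedBall_of_nonpos (hμ : ∀ x r, μ (Metric.sphere x r) = 0) (x : E) {r : ℝ}
    (hr : r ≤ 0) : μ.real (Metric.closedBall x r) = 0 := by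
  have h : μ.real (Metric.closedBall x 0) = 0 := by
    rw [measureReal_def, Metric.closedBall_zero, ← Metric.sphere_zero, hμ]; rfl
  exact le_antisymm (h ▸ measureReal_mono (Metric.closedBall_subset_closedBall hr))
    measureReal_nonneg

lemma measureReal_closedBall_mono (x : E) :
    Monotone fun r => μ.real (Metric.closedBall x r) :=
  fun _ _ h => measureReal_mono (Metric.closedBall_subset_closedBall h)

variable [BorelSpace E]

lemma measureReal_closedBall_eq_cdf (x : E) (r : ℝ) :
    μ.real (Metric.closedBall x r) = cdf (μ.map (dist · x)) r := by
  have hm : Measurable (dist · x : E → ℝ) := (continuous_id.dist continuous_const).measurable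
  have := Measure.isProbabilityMeasure_map (μ := μ) hm.aemeasurable
  rw [cdf_eq_real, map_measureReal_apply hm measurableSet_Iic]
  rfl

lemma continuous_measureReal_closedBall (hμ : ∀ x r, μ (Metric.sphere x r) = 0) (x : E) :
    Continuous fun r => μ.real (Metric.closedBall x r) := by
  have hm : Measurable (dist · x : E → ℝ) := (continuous_id.dist continuous_const).measurable
  have := Measure.isProbabilityMeasure_map (μ := μ) hm.aemeasurable
  simp_rw [measureReal_closedBall_eq_cdf]
  rw [continuous_iff_continuousAt]
  intro r
  set F := cdf (μ.map (dist · x)) with hF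
  have h0 : F.measure {r} = 0 := by
    rw [hF, measure_cdf, Measure.map_apply hm (measurableSet_singleton r)]
    exact hμ x r
  rw [StieltjesFunction.measure_singleton, ENNReal.ofReal_eq_zero] at h0
  rw [F.mono.continuousAt_iff_leftLim_eq_rightLim, F.rightLim_eq]
  exact le_antisymm (F.mono.leftLim_le le_rfl) (by linarith)

lemma bddAbove_measureReal_closedBall_le {t : ℝ} (ht1 : t < 1) (x : E) :
    BddAbove {r | μ.real (Metric.closedBall x r) ≤ t} := by
  have h := tendsto_cdf_atTop (μ.map (dist · x))
  obtain ⟨r, hr⟩ := (h.eventually (lt_mem_nhds ht1)).exists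
  rw [← measureReal_closedBall_eq_cdf] at hr
  refine ⟨r, fun s hs => ?_⟩
  by_contra! hrs
  exact absurd (hr.trans_le (measureReal_closedBall_mono x hrs.le)) (not_lt.2 hs)

lemma measureReal_closedBall_quantileRadius (hμ : ∀ x r, μ (Metric.sphere x r) = 0) {t : ℝ}
    (ht0 : 0 < t) (ht1 : t < 1) (x : E) :
    μ.real (Metric.closedBall x (quantileRadius μ t x)) = t := by
  have hc := continuous_measureReal_closedBall hμ x
  have hb := bddAbove_measureReal_closedBall_le (μ := μ) ht1 x
  refine le_antisymm ?_ ?_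
  · have hcl : IsClosed {r | μ.real (Metric.closedBall x r) ≤ t} := isClosed_le hc continuous_const
    exact hcl.csSup_mem ⟨0, (measureReal_closedBall_of_nonpos hμ x le_rfl).trans_le ht0.le⟩ hb
  · refine ge_of_tendsto
      (hc.continuousWithinAt (s := Set.Ioi (quantileRadius μ t x))).tendsto ?_
    filter_upwards [self_mem_nhdsWithin] with r hr
    by_contra! h
    exact absurd (le_csSup hb h.le) (not_le.2 hr)

lemma quantileRadius_lt_iff (hμ : ∀ x r, μ (Metric.sphere x r) = 0) {t : ℝ}
    (ht0 : 0 < t) (ht1 : t < 1) (x : E) {r : ℝ} :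
    quantileRadius μ t x < r ↔ t < μ.real (Metric.closedBall x r) := by
  constructor
  · intro h
    by_contra! h'
    exact absurd (le_csSup (bddAbove_measureReal_closedBall_le ht1 x) h') (not_le.2 h)
  · intro h
    by_contra! h'
    exact absurd (measureReal_closedBall_mono (μ := μ) x h')
      (not_le.2 (by simpa [measureReal_closedBall_quantileRadius hμ ht0 ht1 x] using h))

lemma quantileRadius_pos (hμ : ∀ x r, μ (Metric.sphere x r) = 0) {t : ℝ}
    (ht0 : 0 < t) (ht1 : t < 1) (x : E) : 0 < quantileRadius μ t x := by
  by_contra! h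
  have := measureReal_closedBall_of_nonpos hμ x h
  rw [measureReal_closedBall_quantileRadius hμ ht0 ht1] at this
  exact ht0.ne' this

variable [SecondCountableTopology E]

lemma measurable_measureReal_closedBall :
    Measurable fun p : E × ℝ => μ.real (Metric.closedBall p.1 p.2) := by
  have hs : MeasurableSet {q : (E × ℝ) × E | dist q.2 q.1.1 ≤ q.1.2} :=
    measurableSet_le (by fun_prop) (by fun_prop)
  exact (measurable_measure_prodMk_left (ν := μ) hs).ennreal_toReal

lemma measurable_quantileRadius (hμ : ∀ x r, μ (Metric.sphere x r) = 0) {t : ℝ}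
    (ht0 : 0 < t) (ht1 : t < 1) : Measurable (quantileRadius μ t) := by
  refine measurable_of_Iio fun r => ?_
  have : quantileRadius μ t ⁻¹' Set.Iio r = {x | t < μ.real (Metric.closedBall x r)} := by
    ext x
    exact quantileRadius_lt_iff hμ ht0 ht1 x
  rw [this]
  exact measurableSet_lt measurable_const
    (measurable_measureReal_closedBall.comp (measurable_id.prodMk measurable_const))

end QuantileRadius

section ConeMeasure

variable [NormedSpace ℝ E]

/-- Within a narrow cone with apex `z`, the points that see `z` within a ball of small probability
have small total probability: the ball around the most distant of these points contains the
others. -/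
lemma measure_cone_le (μ : Measure E) [IsProbabilityMeasure μ] (z u : E) (c : ℝ) :
    μ {x | ‖(x - z) - ‖x - z‖ • u‖ ≤ ‖x - z‖ / 2 ∧ μ.real (Metric.closedBall x ‖x - z‖) ≤ c} ≤
      ENNReal.ofReal c := by
  set A := {x | ‖(x - z) - ‖x - z‖ • u‖ ≤ ‖x - z‖ / 2 ∧ μ.real (Metric.closedBall x ‖x - z‖) ≤ c}
    with hA
  have key : ∀ x ∈ A, ∀ B ⊆ A, (∀ w ∈ B, ‖w - z‖ ≤ ‖x - z‖) → μ B ≤ ENNReal.ofReal c := by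
    intro x hx B hB hBx
    calc μ B ≤ μ (Metric.closedBall x ‖x - z‖) := by
          refine measure_mono fun w hw => ?_
          rw [Metric.mem_closedBall, dist_eq_norm]
          exact dist_le_dist_apex_of_mem_cone hx.1 (hB hw).1 (hBx w hw)
      _ ≤ ENNReal.ofReal c := by
          rw [← ofReal_measureReal]
          exact ENNReal.ofReal_le_ofReal hx.2
  -- If no point of `A` is most distant from `z`, exhaust `A` by its intersections with balls of
  -- rational radius.
  by_cases hmax : ∃ x ∈ A, ∀ w ∈ A, ‖w - z‖ ≤ ‖x - z‖
  · obtain ⟨x, hx, h⟩ := hmax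
    exact key x hx A subset_rfl h
  push Not at hmax
  let I := {q : ℚ // ∃ x ∈ A, (q : ℝ) ≤ ‖x - z‖}
  have hcov : A = ⋃ q : I, {w ∈ A | ‖w - z‖ ≤ ((q : ℚ) : ℝ)} := by
    ext w
    simp only [Set.mem_iUnion, Set.mem_ofPred_eq]
    refine ⟨fun hw => ?_, fun ⟨_, h⟩ => h.1⟩
    obtain ⟨x, hx, hwx⟩ := hmax w hw
    obtain ⟨q, hq1, hq2⟩ := exists_rat_btwn hwx
    exact ⟨⟨q, x, hx, hq2.le⟩, hw, hq1.le⟩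
  have hdir : Directed (· ⊆ ·) fun q : I => {w ∈ A | ‖w - z‖ ≤ ((q : ℚ) : ℝ)} := by
    refine Monotone.directed_le (f := fun q : I => {w ∈ A | ‖w - z‖ ≤ ((q : ℚ) : ℝ)}) ?_
    intro p q hpq w hw
    exact ⟨hw.1, hw.2.trans (by exact_mod_cast hpq)⟩
  rw [hcov, hdir.measure_iUnion]
  refine iSup_le fun q => ?_
  obtain ⟨x, hx, hqx⟩ := q.2
  exact key x hx _ (fun w hw => hw.1) fun w hw => hw.2.trans hqx

variable (E) in
/-- The points having a fixed point `z` in a ball around them of probability at most `c` have total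
probability at most a constant times `c`. -/
lemma exists_measure_closedBall_le_le [ProperSpace E] : ∃ K : ℕ, ∀ (μ : Measure E)
    [IsProbabilityMeasure μ] (z : E) (c : ℝ),
    μ {x | μ.real (Metric.closedBall x ‖x - z‖) ≤ c} ≤ K * ENNReal.ofReal c := by
  obtain ⟨T, hT⟩ := exists_finset_cones E
  refine ⟨T.card, fun μ _ z c => ?_⟩
  calc μ {x | μ.real (Metric.closedBall x ‖x - z‖) ≤ c}
      ≤ μ (⋃ u ∈ T, {x | ‖(x - z) - ‖x - z‖ • u‖ ≤ ‖x - z‖ / 2 ∧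
          μ.real (Metric.closedBall x ‖x - z‖) ≤ c}) := by
        refine measure_mono fun x hx => ?_
        obtain ⟨u, hu, h⟩ := hT (x - z)
        exact Set.mem_iUnion₂.2 ⟨u, hu, h, hx⟩
    _ ≤ ∑ _u ∈ T, ENNReal.ofReal c :=
        (measure_biUnion_finset_le _ _).trans (Finset.sum_le_sum fun u _ => measure_cone_le μ z u c)
    _ = T.card * ENNReal.ofReal c := by simp

end ConeMeasure

end Balls

/-! ### The Bonferroni inequalities and Poisson limits -/

lemma abs_sum_range_neg_one_pow_mul_choose_le (l J : ℕ) (hl : l ≠ 0) :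
    |∑ j ∈ Finset.range J, (-1 : ℝ) ^ j * (l.choose j : ℝ)| ≤ l.choose J := by
  obtain ⟨l, rfl⟩ := Nat.exists_eq_succ_of_ne_zero hl
  rcases J with _ | J
  · simp
  have h : ∑ j ∈ Finset.range (J + 1), (-1 : ℝ) ^ j * ((l + 1).choose j : ℝ) =
      (-1) ^ J * l.choose J := by
    have := Int.alternating_sum_range_choose_eq_choose (n := l) (m := J)
    exact_mod_cast this
  rw [Nat.succ_eq_add_one, h, abs_mul, abs_pow, abs_neg, abs_one, one_pow, one_mul, Nat.abs_cast]
  exact_mod_cast (Nat.choose_succ_succ l J).symm ▸ Nat.le_add_right _ _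

/-- The Bonferroni inequalities for the event that a count `N` equals `m`: the error of a truncated
inclusion-exclusion sum is at most the first omitted term. -/
lemma abs_indicator_sub_sum_choose_le (N m J : ℕ) :
    |(if N = m then (1 : ℝ) else 0) -
      ∑ j ∈ Finset.range J, (-1 : ℝ) ^ j * ((m + j).choose m : ℝ) * (N.choose (m + j) : ℝ)| ≤
      ((m + J).choose m : ℝ) * (N.choose (m + J) : ℝ) := by
  rcases lt_or_ge N m with hN | hN
  · rw [if_neg hN.ne, Finset.sum_eq_zero fun j _ => by
      rw [Nat.choose_eq_zero_of_lt (hN.trans_le (Nat.le_add_right m j))]; simp]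
    simp only [sub_zero, abs_zero]
    positivity
  obtain ⟨l, rfl⟩ := Nat.exists_eq_add_of_le hN
  have hc : ∀ j, ((m + j).choose m : ℝ) * ((m + l).choose (m + j) : ℝ) =
      ((m + l).choose m : ℝ) * (l.choose j : ℝ) := by
    intro j
    rcases le_or_gt j l with hj | hj
    · have := Nat.choose_mul (n := m + l) (k := m + j) (s := m) (Nat.le_add_right m j)
      rw [Nat.add_sub_cancel_left, Nat.add_sub_cancel_left] at this
      rw [mul_comm]
      exact_mod_cast this
    · rw [Nat.choose_eq_zero_of_lt hj, Nat.choose_eq_zero_of_lt (Nat.add_lt_add_left hj m)]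
      simp
  simp_rw [mul_assoc, hc, mul_left_comm _ ((m + l).choose m : ℝ), ← Finset.mul_sum]
  rcases eq_or_ne l 0 with rfl | hl
  · rcases J with _ | J
    · simp
    · rw [Finset.sum_range_succ']
      simp
  · rw [if_neg (by omega), zero_sub, abs_neg, abs_mul, Nat.abs_cast]
    gcongr
    exact abs_sum_range_neg_one_pow_mul_choose_le l J hl

/-- If inclusion-exclusion sums enclose `p n` and the binomial moments `B n k` converge to those of
a Poisson distribution, then `p n` converges to the Poisson probability of `m`. -/
lemma tendsto_of_bonferroni {lam : ℝ} {m : ℕ} {p : ℕ → ℝ} {B : ℕ → ℕ → ℝ}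
    (hB : ∀ k, Tendsto (fun n => B n k) atTop (𝓝 (lam ^ k / k.factorial)))
    (hp : ∀ n J, |p n - ∑ j ∈ Finset.range J, (-1 : ℝ) ^ j * ((m + j).choose m : ℝ) * B n (m + j)| ≤
      ((m + J).choose m : ℝ) * B n (m + J)) :
    Tendsto p atTop (𝓝 (Real.exp (-lam) * lam ^ m / m.factorial)) := by
  have hterm : ∀ j, ((m + j).choose m : ℝ) * (lam ^ (m + j) / (m + j).factorial) =
      lam ^ m / m.factorial * (lam ^ j / j.factorial) := by
    intro j
    have h := Nat.choose_mul_factorial_mul_factorial (Nat.le_add_right m j)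
    rw [Nat.add_sub_cancel_left] at h
    rw [← h, pow_add]
    have : ((m + j).choose m : ℝ) ≠ 0 := by
      exact_mod_cast (Nat.choose_pos (Nat.le_add_right m j)).ne'
    push_cast
    field_simp
  have hsum : Tendsto (fun J => ∑ j ∈ Finset.range J,
      (-1 : ℝ) ^ j * ((m + j).choose m : ℝ) * (lam ^ (m + j) / (m + j).factorial)) atTop
      (𝓝 (Real.exp (-lam) * lam ^ m / m.factorial)) := by
    have h := (NormedSpace.expSeries_div_hasSum_exp (-lam)).tendsto_sum_nat
    rw [← Real.exp_eq_exp_ℝ] at h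
    convert! h.const_mul (lam ^ m / m.factorial) using 2 with J
    · rw [Finset.mul_sum]
      refine Finset.sum_congr rfl fun j _ => ?_
      rw [mul_assoc, hterm, neg_pow lam j]
      ring
    · ring
  have herr : Tendsto (fun J => ((m + J).choose m : ℝ) * (lam ^ (m + J) / (m + J).factorial))
      atTop (𝓝 0) := by
    simp_rw [hterm]
    simpa using
      (FloorSemiring.tendsto_pow_div_factorial_atTop lam).const_mul (lam ^ m / m.factorial)
  rw [Metric.tendsto_atTop]
  intro ε hε
  obtain ⟨J, hJ1, hJ2⟩ := ((Metric.tendsto_nhds.1 hsum (ε / 4) (by positivity)).and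
    (herr.eventually (gt_mem_nhds (show (0 : ℝ) < ε / 4 by positivity)))).exists
  have h1 : Tendsto (fun n => ∑ j ∈ Finset.range J,
      (-1 : ℝ) ^ j * ((m + j).choose m : ℝ) * B n (m + j)) atTop _ :=
    tendsto_finsetSum _ fun j _ => (hB (m + j)).const_mul _
  have h2 := (hB (m + J)).const_mul ((m + J).choose m : ℝ)
  obtain ⟨n₀, hn₀⟩ := eventually_atTop.1 ((Metric.tendsto_nhds.1 h1 (ε / 4) (by positivity)).and
    (h2.eventually (gt_mem_nhds hJ2)))
  refine ⟨n₀, fun n hn => ?_⟩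
  obtain ⟨h3, h4⟩ := hn₀ n hn
  have h5 := hp n J
  rw [Real.dist_eq] at *
  have := abs_sub_lt_iff.1 h3
  have := abs_sub_lt_iff.1 hJ1
  have := abs_le.1 h5
  rw [abs_sub_lt_iff]
  constructor <;> linarith

/-- Method of binomial moments: bounded counts whose binomial moments converge to those of a Poisson
distribution have converging point probabilities. -/
lemma tendsto_measureReal_eq_of_binomial_moments {α : ℕ → Type*} [∀ n, MeasurableSpace (α n)]
    (Q : ∀ n, Measure (α n)) [∀ n, IsProbabilityMeasure (Q n)] (N : ∀ n, α n → ℕ)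
    (hN : ∀ n, Measurable (N n)) (hbdd : ∀ n x, N n x ≤ n) {lam : ℝ}
    (hmom : ∀ k, Tendsto (fun n => ∫ x, ((N n x).choose k : ℝ) ∂(Q n)) atTop
      (𝓝 (lam ^ k / k.factorial))) (m : ℕ) :
    Tendsto (fun n => (Q n).real {x | N n x = m}) atTop
      (𝓝 (Real.exp (-lam) * lam ^ m / m.factorial)) := by
  refine tendsto_of_bonferroni hmom fun n J => ?_
  have hint : ∀ k, Integrable (fun x => ((N n x).choose k : ℝ)) (Q n) := by
    intro k
    refine Integrable.of_bound (C := (n.choose k : ℝ))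
      ((measurable_from_nat (f := fun i : ℕ => (i.choose k : ℝ))).comp (hN n)).aestronglyMeasurable
      (Eventually.of_forall fun x => ?_)
    rw [Real.norm_of_nonneg (by positivity)]
    exact_mod_cast Nat.choose_le_choose k (hbdd n x)
  have hset : MeasurableSet {x | N n x = m} := hN n (measurableSet_singleton m)
  have hp : (Q n).real {x | N n x = m} = ∫ x, (if N n x = m then (1 : ℝ) else 0) ∂(Q n) := by
    rw [← integral_indicator_one hset]
    exact integral_congr_ae (Eventually.of_forall fun x => by simp [Set.indicator_apply])
  have hint1 : Integrable (fun x => if N n x = m then (1 : ℝ) else 0) (Q n) := by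
    refine Integrable.of_bound (C := 1) ?_ (Eventually.of_forall fun x => by split_ifs <;> simp)
    exact (Measurable.ite hset measurable_const measurable_const).aestronglyMeasurable
  have hint2 : Integrable (fun x => ∑ j ∈ Finset.range J,
      (-1 : ℝ) ^ j * ((m + j).choose m : ℝ) * ((N n x).choose (m + j) : ℝ)) (Q n) :=
    integrable_finsetSum _ fun j _ => (hint (m + j)).const_mul _
  simp_rw [← integral_const_mul]
  rw [hp, ← integral_finsetSum _ fun j _ => (hint (m + j)).const_mul _,
    ← integral_sub hint1 hint2, ← Real.norm_eq_abs]
  refine (norm_integral_le_integral_norm _).trans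
    (integral_mono (hint1.sub hint2).norm ((hint (m + J)).const_mul _) fun x => ?_)
  exact abs_indicator_sub_sum_choose_le (N n x) m J

/-- Convergence of all point probabilities implies weak convergence on `ℕ`. -/
lemma tendsto_probabilityMeasure_nat {ν : ℕ → ProbabilityMeasure ℕ} {ν₀ : ProbabilityMeasure ℕ}
    (h : ∀ m, Tendsto (fun n => (ν n : Measure ℕ).real {m}) atTop (𝓝 ((ν₀ : Measure ℕ).real {m}))) :
    Tendsto ν atTop (𝓝 ν₀) := by
  refine tendsto_of_forall_isOpen_le_liminf' fun G _ => ?_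
  have hG : ∀ ρ : Measure ℕ, ρ G = ∑' m, G.indicator (fun m => ρ {m}) m := fun ρ => by
    rw [← tsum_subtype, ← ρ.tsum_indicator_apply_singleton G (.of_discrete), ← tsum_subtype]
  simp_rw [hG, ← lintegral_count]
  refine (lintegral_mono fun m => ?_).trans (lintegral_liminf_le fun n => .of_discrete)
  refine le_of_eq (Tendsto.liminf_eq ?_).symm
  by_cases hm : m ∈ G
  · simp only [Set.indicator_of_mem hm]
    exact (ENNReal.tendsto_toReal_iff (fun n => measure_ne_top _ _) (measure_ne_top _ _)).1 (h m)
  · simp [Set.indicator_of_notMem hm]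

/-! ### Asymptotics of the threshold -/

/-- The exceedance level `(y + ln n) / n` for the probability of a nearest neighbour ball. -/
noncomputable def level (y : ℝ) (n : ℕ) : ℝ := (y + Real.log n) / n

lemma tendsto_add_log_atTop (y : ℝ) : Tendsto (fun n : ℕ => y + Real.log n) atTop atTop :=
  tendsto_atTop_add_const_left _ _ (Real.tendsto_log_atTop.comp tendsto_natCast_atTop_atTop)

lemma mul_level (y : ℝ) {n : ℕ} (hn : n ≠ 0) : n * level y n = y + Real.log n := by
  rw [level]; field_simp

lemma natCast_eq_exp (y : ℝ) {n : ℕ} (hn : n ≠ 0) :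
    (n : ℝ) = Real.exp (n * level y n - y) := by
  rw [mul_level y hn, add_sub_cancel_left, Real.exp_log (by positivity)]

lemma tendsto_pow_mul_exp_neg_mul (p : ℕ) {a : ℝ} (ha : 0 < a) :
    Tendsto (fun v : ℝ => v ^ p * Real.exp (-(a * v))) atTop (𝓝 0) := by
  have h := (Real.tendsto_pow_mul_exp_neg_atTop_nhds_zero p).comp (tendsto_id.const_mul_atTop ha)
  have h2 := h.const_mul (a ^ p)⁻¹
  rw [mul_zero] at h2
  refine h2.congr fun v => ?_
  simp only [Function.comp, id]
  rw [mul_pow]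
  field_simp

lemma level_eq (y : ℝ) {n : ℕ} (hn : n ≠ 0) :
    level y n = Real.exp y * (n * level y n * Real.exp (-(n * level y n))) := by
  have h : (n : ℝ) ≠ 0 := by positivity
  have e : Real.exp y * Real.exp (-(n * level y n)) = (n : ℝ)⁻¹ := by
    rw [← Real.exp_add]
    conv_rhs => rw [natCast_eq_exp y hn]
    rw [← Real.exp_neg]; ring_nf
  calc level y n = n * level y n * (n : ℝ)⁻¹ := by field_simp
    _ = _ := by rw [← e]; ring

lemma tendsto_mul_level (y : ℝ) : Tendsto (fun n : ℕ => n * level y n) atTop atTop :=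
  (tendsto_add_log_atTop y).congr' <| by
    filter_upwards [eventually_ne_atTop 0] with n hn using (mul_level y hn).symm

lemma tendsto_level (y : ℝ) : Tendsto (level y) atTop (𝓝 0) := by
  have h := ((tendsto_pow_mul_exp_neg_mul 1 one_pos).comp (tendsto_mul_level y)).const_mul
    (Real.exp y)
  rw [mul_zero] at h
  refine h.congr' ?_
  filter_upwards [eventually_ne_atTop 0] with n hn
  simp only [Function.comp, pow_one, one_mul]
  exact (level_eq y hn).symm

lemma eventually_level_pos (y : ℝ) : ∀ᶠ n : ℕ in atTop, 0 < level y n := by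
  filter_upwards [(tendsto_mul_level y).eventually_gt_atTop 0] with n hn
  exact pos_of_mul_pos_right hn (Nat.cast_nonneg n)

lemma tendsto_mul_level_sq (y : ℝ) : Tendsto (fun n : ℕ => n * level y n ^ 2) atTop (𝓝 0) := by
  have h := ((tendsto_pow_mul_exp_neg_mul 2 one_pos).comp (tendsto_mul_level y)).const_mul
    (Real.exp y)
  rw [mul_zero] at h
  refine h.congr' ?_
  filter_upwards [eventually_ne_atTop 0] with n hn
  simp only [Function.comp, one_mul]
  calc Real.exp y * ((n * level y n) ^ 2 * Real.exp (-(n * level y n)))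
      = n * level y n * (Real.exp y * (n * level y n * Real.exp (-(n * level y n)))) := by ring
    _ = n * level y n ^ 2 := by rw [← level_eq y hn]; ring

/-- The contribution of `k` pairwise disjoint balls. -/
lemma tendsto_pow_mul_exp_level (y : ℝ) (k : ℕ) :
    Tendsto (fun n : ℕ => (n : ℝ) ^ k * Real.exp (-(k * level y n * (n - k)))) atTop
      (𝓝 (Real.exp (-(k * y)))) := by
  have h : Tendsto (fun n : ℕ => Real.exp (-(k * y) + k ^ 2 * level y n)) atTop
      (𝓝 (Real.exp (-(k * y) + k ^ 2 * 0))) :=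
    (Real.continuous_exp.tendsto _).comp (((tendsto_level y).const_mul _).const_add _)
  rw [mul_zero, add_zero] at h
  refine h.congr' ?_
  filter_upwards [eventually_ne_atTop 0] with n hn
  have : (n : ℝ) ^ k = Real.exp (k * (n * level y n - y)) := by
    rw [Real.exp_nat_mul, ← natCast_eq_exp y hn]
  rw [this, ← Real.exp_add]
  congr 1
  ring

/-- The contribution of `k` balls of which two overlap: a subfamily of `m` balls covers probability
`m - β` times the level, while the overlaps cost `k + 1 - m` factors of the order of the level. -/
lemma tendsto_pow_mul_level_pow_mul_exp (y : ℝ) {β : ℝ} (hβ : β < 1) {k m : ℕ} (hm : 1 ≤ m)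
    (hmk : m ≤ k) :
    Tendsto (fun n : ℕ => (n : ℝ) ^ k *
      (level y n ^ (k + 1 - m) * Real.exp (-((m - β) * level y n * (n - k))))) atTop (𝓝 0) := by
  have h1 := (tendsto_pow_mul_exp_neg_mul (k + 1 - m) (sub_pos.2 hβ)).comp (tendsto_mul_level y)
  have h2 : Tendsto (fun n : ℕ => Real.exp (-((m - 1) * y) + (m - β) * k * level y n)) atTop
      (𝓝 (Real.exp (-((m - 1) * y) + (m - β) * k * 0))) :=
    (Real.continuous_exp.tendsto _).comp (((tendsto_level y).const_mul _).const_add _)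
  have h := h1.mul h2
  rw [zero_mul] at h
  refine h.congr' ?_
  filter_upwards [eventually_ne_atTop 0] with n hn
  obtain ⟨i, rfl⟩ := Nat.exists_eq_add_of_le hm
  obtain ⟨l, rfl⟩ := Nat.exists_eq_add_of_le hmk
  have e1 : 1 + i + l + 1 - (1 + i) = l + 1 := by omega
  have e2 : (n : ℝ) ^ (1 + i + l) = n ^ (l + 1) * Real.exp (i * (n * level y n - y)) := by
    rw [Real.exp_nat_mul, ← natCast_eq_exp y hn]; ring
  simp only [Function.comp]
  rw [e1, e2, mul_pow, mul_assoc, ← Real.exp_add, mul_mul_mul_comm, ← Real.exp_add, mul_assoc,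
    ← mul_assoc]
  congr 2
  push_cast
  ring

/-- The lower bound for the joint probability of `k` exceedances has the order of its upper
bound. -/
lemma tendsto_pow_mul_one_sub_level_pow (y : ℝ) (k : ℕ) :
    ∃ g : ℕ → ℝ, Tendsto g atTop (𝓝 (Real.exp (-(k * y)))) ∧ ∀ᶠ n : ℕ in atTop,
      g n ≤ (n : ℝ) ^ k * ((1 - k ^ 2 * level y n) * (1 - k * level y n) ^ (n - k)) := by
  refine ⟨fun n => (1 - k ^ 2 * level y n) *
    Real.exp (-(k * y) - k ^ 2 * (n * level y n ^ 2) / (1 - k * level y n)), ?_, ?_⟩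
  · have h1 : Tendsto (fun n => 1 - (k : ℝ) ^ 2 * level y n) atTop (𝓝 (1 - (k : ℝ) ^ 2 * 0)) :=
      ((tendsto_level y).const_mul _).const_sub _
    have h2 : Tendsto (fun n => 1 - (k : ℝ) * level y n) atTop (𝓝 (1 - (k : ℝ) * 0)) :=
      ((tendsto_level y).const_mul _).const_sub _
    have h3 := (((tendsto_mul_level_sq y).const_mul ((k : ℝ) ^ 2)).div h2 (by simp)).const_sub
      (-(k * y))
    have h4 := h1.mul ((Real.continuous_exp.tendsto _).comp h3)
    simpa using h4
  · have h1 : ∀ᶠ n in atTop, (k : ℝ) ^ 2 * level y n < 1 := by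
      have := (tendsto_level y).const_mul ((k : ℝ) ^ 2)
      rw [mul_zero] at this
      exact this.eventually (gt_mem_nhds one_pos)
    have h2 : ∀ᶠ n in atTop, (k : ℝ) * level y n < 1 := by
      have := (tendsto_level y).const_mul (k : ℝ)
      rw [mul_zero] at this
      exact this.eventually (gt_mem_nhds one_pos)
    filter_upwards [h1, h2, eventually_level_pos y, eventually_ne_atTop 0] with n h1 h2 h3 hn
    set t := level y n with ht
    have hu : 0 < 1 - k * t := by linarith
    have e1 : (n : ℝ) ^ k = Real.exp (k * (n * t - y)) := by
      rw [Real.exp_nat_mul, ← natCast_eq_exp y hn]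
    have e2 : Real.exp (-(k * t / (1 - k * t))) ≤ 1 - k * t := by
      have := Real.add_one_le_exp (k * t / (1 - k * t))
      rw [Real.exp_neg, inv_le_comm₀ (Real.exp_pos _) hu]
      refine le_trans (le_of_eq ?_) this
      field_simp
      ring
    have e3 : (1 - k * t) ^ n ≤ (1 - k * t) ^ (n - k) :=
      pow_le_pow_of_le_one hu.le (by have : 0 ≤ k * t := by positivity
                                     linarith) (Nat.sub_le n k)
    have e4 : Real.exp (n * -(k * t / (1 - k * t))) ≤ (1 - k * t) ^ n := by
      rw [Real.exp_nat_mul]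
      exact pow_le_pow_left₀ (Real.exp_pos _).le e2 n
    rw [mul_left_comm ((n : ℝ) ^ k)]
    refine mul_le_mul_of_nonneg_left ?_ (sub_nonneg.2 h1.le)
    refine le_trans (le_of_eq ?_) (mul_le_mul_of_nonneg_left (e4.trans e3) (by positivity))
    rw [e1, ← Real.exp_add]
    congr 1
    field_simp
    ring

lemma tendsto_choose_div_pow (k : ℕ) :
    Tendsto (fun n : ℕ => (n.choose k : ℝ) / n ^ k) atTop (𝓝 (1 / k.factorial)) := by
  have h : Tendsto (fun n : ℕ => (n : ℝ) * (n : ℝ)⁻¹) atTop (𝓝 1) :=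
    tendsto_const_nhds.congr' <| by
      filter_upwards [eventually_ne_atTop 0] with n hn
      rw [mul_inv_cancel₀ (by positivity)]
  have h2 := tendsto_choose_mul_pow_atTop k h
  rw [one_pow] at h2
  refine h2.congr fun n => ?_
  rw [inv_pow, div_eq_mul_inv]

/-! ### Integrating out coordinates of a product measure -/

lemma prod_indicator_one_eq_ite {ι F : Type*} (J : Finset ι) (V : Set F) (x : ι → F)
    [Decidable (∀ j ∈ J, x j ∈ V)] :
    ∏ j ∈ J, V.indicator (fun _ => (1 : ENNReal)) (x j) = if ∀ j ∈ J, x j ∈ V then 1 else 0 := by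
  split_ifs with h
  · exact Finset.prod_eq_one fun j hj => Set.indicator_of_mem (h j hj) _
  · push Not at h
    obtain ⟨j, hj, hjV⟩ := h
    exact Finset.prod_eq_zero hj (Set.indicator_of_notMem hjV _)

section ProductMeasure

variable {ι F : Type*} [Fintype ι] [DecidableEq ι] [MeasurableSpace F]
  {μ : Measure F} [IsProbabilityMeasure μ]

/-- Resampling one coordinate does not change an integral against a product measure. -/
lemma lintegral_pi_eq_lintegral_update {f : (ι → F) → ENNReal} (hf : Measurable f) (j : ι) :
    ∫⁻ x, f x ∂(Measure.pi fun _ => μ) =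
      ∫⁻ x, ∫⁻ u, f (Function.update x j u) ∂μ ∂(Measure.pi fun _ => μ) := by
  have hg : Measurable fun x : ι → F => ∫⁻ u, f (Function.update x j u) ∂μ :=
    (hf.comp (measurable_update' (a := j))).lintegral_prod_right'
  obtain ⟨u₀⟩ : Nonempty F := nonempty_of_isProbabilityMeasure μ
  rw [lintegral_eq_lmarginal_univ (fun _ => u₀), lintegral_eq_lmarginal_univ (fun _ => u₀),
    lmarginal_erase' _ hf (Finset.mem_univ j), lmarginal_erase' _ hg (Finset.mem_univ j)]
  simp

/-- If `h` and the random set `V` do not depend on the coordinates in `J`, these coordinates hit `V`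
independently of each other. -/
lemma lintegral_mul_prod_indicator {V : (ι → F) → Set F}
    (hV : MeasurableSet {p : (ι → F) × F | p.2 ∈ V p.1}) (J : Finset ι)
    (hVJ : ∀ j ∈ J, ∀ x u, V (Function.update x j u) = V x)
    {h : (ι → F) → ENNReal} (hh : Measurable h)
    (hhJ : ∀ j ∈ J, ∀ x u, h (Function.update x j u) = h x) :
    ∫⁻ x, h x * ∏ j ∈ J, (V x).indicator (fun _ => 1) (x j) ∂(Measure.pi fun _ => μ) =
      ∫⁻ x, h x * μ (V x) ^ J.card ∂(Measure.pi fun _ => μ) := by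
  have hVm : Measurable fun x => μ (V x) := measurable_measure_prodMk_left hV
  have hind : ∀ j, Measurable fun x : ι → F => (V x).indicator (fun _ => (1 : ENNReal)) (x j) :=
    fun j => (measurable_const.indicator hV).comp (measurable_id.prodMk (measurable_pi_apply j))
  induction J using Finset.induction generalizing h with
  | empty => simp
  | insert j J hj ih =>
    have hm : Measurable fun x => h x *
        ∏ i ∈ insert j J, (V x).indicator (fun _ => (1 : ENNReal)) (x i) :=
      hh.mul (Finset.measurable_fun_prod _ fun i _ => hind i)
    rw [lintegral_pi_eq_lintegral_update hm j]
    have hinner : ∀ x : ι → F, ∫⁻ u, h (Function.update x j u) *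
        ∏ i ∈ insert j J, (V (Function.update x j u)).indicator (fun _ => (1 : ENNReal))
          (Function.update x j u i) ∂μ =
        (h x * μ (V x)) * ∏ i ∈ J, (V x).indicator (fun _ => 1) (x i) := by
      intro x
      have e : ∀ u, h (Function.update x j u) *
          ∏ i ∈ insert j J, (V (Function.update x j u)).indicator (fun _ => (1 : ENNReal))
            (Function.update x j u i) =
          (h x * ∏ i ∈ J, (V x).indicator (fun _ => 1) (x i)) *
            (V x).indicator (fun _ => 1) u := by
        intro u
        rw [hhJ j (Finset.mem_insert_self j J), hVJ j (Finset.mem_insert_self j J),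
          Finset.prod_insert hj, Function.update_self]
        have : ∏ i ∈ J, (V x).indicator (fun _ => (1 : ENNReal)) (Function.update x j u i) =
            ∏ i ∈ J, (V x).indicator (fun _ => 1) (x i) := by
          refine Finset.prod_congr rfl fun i hi => ?_
          rw [Function.update_of_ne (ne_of_mem_of_not_mem hi hj)]
        rw [this]
        ring
      have hVx : MeasurableSet (V x) := measurable_prodMk_left hV
      simp_rw [e]
      rw [lintegral_const_mul _ (measurable_const.indicator hVx), lintegral_indicator hVx]
      simp only [lintegral_const, one_mul, Measure.restrict_apply_univ]
      ring
    simp_rw [hinner]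
    rw [ih (fun i hi => hVJ i (Finset.mem_insert_of_mem hi)) (h := fun x => h x * μ (V x))
      (hh.mul hVm) fun i hi x u => by
        simp only [hhJ i (Finset.mem_insert_of_mem hi), hVJ i (Finset.mem_insert_of_mem hi)]]
    refine lintegral_congr fun x => ?_
    rw [Finset.card_insert_of_notMem hj, pow_succ']
    ring

end ProductMeasure

/-! ### Overlapping balls -/

section Overlap

variable {E : Type*} [NormedAddCommGroup E] [MeasurableSpace E]

/-- Two points of the support are linked at level `t` if neither of them lies in the interior of the
ball of `μ`-probability `t` around the other one, but these two balls meet. -/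
def Linked (μ : Measure E) (t : ℝ) (x z : E) : Prop :=
  x ∈ μ.support ∧ z ∈ μ.support ∧ max (quantileRadius μ t x) (quantileRadius μ t z) ≤ ‖x - z‖ ∧
    ‖x - z‖ ≤ quantileRadius μ t x + quantileRadius μ t z

lemma Linked.symm {μ : Measure E} {t : ℝ} {x z : E} (h : Linked μ t x z) : Linked μ t z x :=
  ⟨h.2.1, h.1, by rw [max_comm, norm_sub_rev]; exact h.2.2.1,
    by rw [add_comm, norm_sub_rev]; exact h.2.2.2⟩

/-- The overlap and doubling conditions for the balls of `μ`-probability `t` around two points of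
the support neither of which lies in the interior of the other ball. -/
structure BallCondition (μ : Measure E) (β C t : ℝ) : Prop where
  inter_le : ∀ x ∈ μ.support, ∀ z ∈ μ.support,
    max (quantileRadius μ t x) (quantileRadius μ t z) ≤ ‖x - z‖ →
    μ.real (Metric.closedBall x (quantileRadius μ t x) ∩
      Metric.closedBall z (quantileRadius μ t z)) ≤ β * t
  doubling : ∀ x ∈ μ.support, ∀ z ∈ μ.support,
    max (quantileRadius μ t x) (quantileRadius μ t z) ≤ ‖x - z‖ →
    μ.real (Metric.closedBall z (2 * quantileRadius μ t z)) ≤ C * t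

variable {μ : Measure E} [IsProbabilityMeasure μ] {β C t : ℝ}

/-- A link to a fixed point `z` has probability of order `t`: either the new point lies in the
doubled ball around `z`, or `z` lies in the doubled ball around the new point. -/
lemma measure_linked_le {K : ℕ}
    (hK : ∀ (z : E) (c : ℝ), μ {x | μ.real (Metric.closedBall x ‖x - z‖) ≤ c} ≤
      K * ENNReal.ofReal c)
    (hcond : BallCondition μ β C t) (z : E) :
    μ {x | Linked μ t x z} ≤ (K + 1) * ENNReal.ofReal (C * t) := by
  rcases Set.eq_empty_or_nonempty {x | Linked μ t x z} with h | ⟨x₀, h₀⟩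
  · simp [h]
  have hz := hcond.doubling x₀ h₀.1 z h₀.2.1 h₀.2.2.1
  have hsub : {x | Linked μ t x z} ⊆ {x | μ.real (Metric.closedBall x ‖x - z‖) ≤ C * t} ∪
      Metric.closedBall z (2 * quantileRadius μ t z) := by
    intro x hx
    rcases le_total (quantileRadius μ t z) (quantileRadius μ t x) with h | h
    · left
      have hx' := hx.symm
      refine le_trans (measureReal_closedBall_mono x ?_)
        (hcond.doubling z hx'.1 x hx'.2.1 hx'.2.2.1)
      linarith [hx.2.2.2]
    · right
      rw [Metric.mem_closedBall, dist_eq_norm]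
      linarith [hx.2.2.2]
  refine (measure_mono hsub).trans ((measure_union_le _ _).trans ?_)
  rw [add_mul, one_mul]
  gcongr
  · exact hK z (C * t)
  · rw [← ofReal_measureReal]
    exact ENNReal.ofReal_le_ofReal hz

lemma measurableSet_linked [BorelSpace E] [SecondCountableTopology E]
    (hμ : ∀ x r, μ (Metric.sphere x r) = 0) (ht0 : 0 < t) (ht1 : t < 1) :
    MeasurableSet {p : E × E | Linked μ t p.1 p.2} := by
  have hρ := measurable_quantileRadius hμ ht0 ht1
  have h1 : MeasurableSet μ.support := Measure.isClosed_support.measurableSet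
  refine (measurable_fst h1).inter ((measurable_snd h1).inter (.inter ?_ ?_))
  · exact measurableSet_le ((hρ.comp measurable_fst).max (hρ.comp measurable_snd)) (by fun_prop)
  · exact measurableSet_le (by fun_prop) ((hρ.comp measurable_fst).add (hρ.comp measurable_snd))

end Overlap

section Configurations

variable {E ι : Type*} [NormedAddCommGroup E] [MeasurableSpace E]

/-- The points of the configuration `x` with index in `s` do not lie in each other's balls of
`μ`-probability `t`. -/
def Separated (μ : Measure E) (t : ℝ) (s : Finset ι) (x : ι → E) : Prop :=
  ∀ i ∈ s, ∀ j ∈ s, j ≠ i → quantileRadius μ t (x i) < ‖x i - x j‖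

/-- The union of the balls of `μ`-probability `t` around the points with index in `s`. -/
def ballUnion (μ : Measure E) (t : ℝ) (s : Finset ι) (x : ι → E) : Set E :=
  ⋃ i ∈ s, Metric.closedBall (x i) (quantileRadius μ t (x i))

lemma mem_ballUnion {μ : Measure E} {t : ℝ} {s : Finset ι} {x : ι → E} {u : E} :
    u ∈ ballUnion μ t s x ↔ ∃ i ∈ s, ‖x i - u‖ ≤ quantileRadius μ t (x i) := by
  simp [ballUnion, dist_eq_norm, norm_sub_rev]

lemma Separated.mono {μ : Measure E} {t : ℝ} {s I : Finset ι} {x : ι → E}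
    (h : Separated μ t s x) (hI : I ⊆ s) : Separated μ t I x :=
  fun i hi j hj => h i (hI hi) j (hI hj)

lemma Separated.max_quantileRadius_le {μ : Measure E} {t : ℝ} {s : Finset ι} {x : ι → E}
    (h : Separated μ t s x) {i j : ι} (hi : i ∈ s) (hj : j ∈ s) (hij : i ≠ j) :
    max (quantileRadius μ t (x i)) (quantileRadius μ t (x j)) ≤ ‖x i - x j‖ :=
  max_le (h i hi j hj hij.symm).le (by rw [norm_sub_rev]; exact (h j hj i hi hij).le)

/-- Separated points of the support which are not linked have disjoint balls. -/
lemma Separated.disjoint_closedBall {μ : Measure E} {t : ℝ} {s : Finset ι} {x : ι → E}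
    (h : Separated μ t s x) (hx : ∀ i, x i ∈ μ.support) {i j : ι} (hi : i ∈ s) (hj : j ∈ s)
    (hij : i ≠ j) (hl : ¬ Linked μ t (x i) (x j)) :
    Disjoint (Metric.closedBall (x i) (quantileRadius μ t (x i)))
      (Metric.closedBall (x j) (quantileRadius μ t (x j))) := by
  refine Metric.closedBall_disjoint_closedBall ?_
  rw [dist_eq_norm]
  by_contra! hle
  exact hl ⟨hx i, hx j, h.max_quantileRadius_le hi hj hij, hle⟩

variable [BorelSpace E] {μ : Measure E} [IsProbabilityMeasure μ] {β C t : ℝ}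

lemma measureReal_ballUnion_le (hμ : ∀ x r, μ (Metric.sphere x r) = 0)
    (ht0 : 0 < t) (ht1 : t < 1) (s : Finset ι) (x : ι → E) :
    μ.real (ballUnion μ t s x) ≤ s.card * t := by
  refine (measureReal_biUnion_finset_le _ _).trans (le_of_eq ?_)
  simp [measureReal_closedBall_quantileRadius hμ ht0 ht1]

lemma measureReal_ballUnion_of_not_linked (hμ : ∀ x r, μ (Metric.sphere x r) = 0)
    (ht0 : 0 < t) (ht1 : t < 1) {s : Finset ι} {x : ι → E}
    (hx : ∀ i, x i ∈ μ.support) (hsep : Separated μ t s x)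
    (hl : ∀ i ∈ s, ∀ j ∈ s, i ≠ j → ¬ Linked μ t (x i) (x j)) :
    μ.real (ballUnion μ t s x) = s.card * t := by
  rw [ballUnion, measureReal_biUnion_finset]
  · simp [measureReal_closedBall_quantileRadius hμ ht0 ht1]
  · exact fun i hi j hj hij => hsep.disjoint_closedBall hx hi hj hij (hl i hi j hj hij)
  · exact fun i _ => measurableSet_closedBall

/-- Balls of which only those with index `a` and `b` overlap cover almost as much as disjoint
ones. -/
lemma le_measureReal_ballUnion [DecidableEq ι] (hμ : ∀ x r, μ (Metric.sphere x r) = 0)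
    (ht0 : 0 < t) (ht1 : t < 1) (hcond : BallCondition μ β C t) {I : Finset ι} {x : ι → E}
    (hx : ∀ i, x i ∈ μ.support) (hsep : Separated μ t I x) {a b : ι} (ha : a ∈ I) (hb : b ∈ I)
    (hab : a ≠ b)
    (hl : ∀ i ∈ I, ∀ j ∈ I, i ≠ j → i ≠ a → i ≠ b → ¬ Linked μ t (x i) (x j)) :
    (I.card - β) * t ≤ μ.real (ballUnion μ t I x) := by
  set I' := (I.erase a).erase b with hI'
  have hmem : ∀ i ∈ I', i ∈ I ∧ i ≠ a ∧ i ≠ b := by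
    intro i hi
    simp only [hI', Finset.mem_erase] at hi
    exact ⟨hi.2.2, hi.2.1, hi.1⟩
  set B := fun i => Metric.closedBall (x i) (quantileRadius μ t (x i)) with hB
  have hBt : ∀ i, μ.real (B i) = t := fun i => measureReal_closedBall_quantileRadius hμ ht0 ht1 _
  have hsub : I' ⊆ I := fun i hi => (hmem i hi).1
  have h1 : μ.real (ballUnion μ t I' x) = I'.card * t :=
    measureReal_ballUnion_of_not_linked hμ ht0 ht1 hx (hsep.mono hsub) fun i hi j hj hij =>
      hl i (hsub hi) j (hsub hj) hij (hmem i hi).2.1 (hmem i hi).2.2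
  have h2 : μ.real (B a ∪ B b) + μ.real (B a ∩ B b) = t + t := by
    rw [measureReal_union_add_inter measurableSet_closedBall, hBt, hBt]
  have h3 : μ.real (B a ∩ B b) ≤ β * t :=
    hcond.inter_le _ (hx a) _ (hx b) (hsep.max_quantileRadius_le ha hb hab)
  have hdisj : Disjoint (ballUnion μ t I' x) (B a ∪ B b) := by
    refine Set.disjoint_iUnion₂_left.2 fun i hi => ?_
    obtain ⟨hiI, hia, hib⟩ := hmem i hi
    exact Disjoint.union_right (hsep.disjoint_closedBall hx hiI ha hia (hl i hiI a ha hia hia hib))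
      (hsep.disjoint_closedBall hx hiI hb hib (hl i hiI b hb hib hia hib))
  have hle : μ.real (ballUnion μ t I' x) + μ.real (B a ∪ B b) ≤ μ.real (ballUnion μ t I x) := by
    rw [← measureReal_union hdisj (measurableSet_closedBall.union measurableSet_closedBall)]
    refine measureReal_mono (Set.union_subset ?_ (Set.union_subset ?_ ?_))
    · exact Set.biUnion_subset_biUnion_left hsub
    · exact Set.subset_biUnion_of_mem (u := B) ha
    · exact Set.subset_biUnion_of_mem (u := B) hb
  have hcard : (I.card : ℝ) = I'.card + 2 := by
    have e1 := Finset.card_erase_add_one ha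
    have e2 := Finset.card_erase_add_one (Finset.mem_erase.2 ⟨hab.symm, hb⟩)
    have : I.card = I'.card + 2 := by rw [← e1, ← e2]
    exact_mod_cast this
  rw [hcard]
  linarith

end Configurations

/-! ### Joint probabilities of large nearest neighbour balls -/

/-- A maximal subfamily of `s` that contains `a` and `b` and has no links other than between `a` and
`b`: every other element of `s` is linked to it. -/
lemma exists_maximal_unlinked {ι : Type*} [DecidableEq ι] {R : ι → ι → Prop}
    (hR : ∀ i j, R i j → R j i) {s : Finset ι} {a b : ι} (ha : a ∈ s) (hb : b ∈ s) :
    ∃ I ⊆ s, a ∈ I ∧ b ∈ I ∧ (∀ i ∈ I, ∀ j ∈ I, i ≠ j → i ≠ a → i ≠ b → ¬ R i j) ∧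
      ∀ j ∈ s \ I, ∃ i ∈ I, R j i := by
  classical
  -- Among the admissible subfamilies, `{a, b}` being one, take one with the most elements.
  let good : Finset ι → Prop := fun I =>
    a ∈ I ∧ b ∈ I ∧ ∀ i ∈ I, ∀ j ∈ I, i ≠ j → i ≠ a → i ≠ b → ¬ R i j
  have hne : (s.powerset.filter good).Nonempty := by
    refine ⟨{a, b}, Finset.mem_filter.2 ⟨?_, by simp, by simp, ?_⟩⟩
    · rw [Finset.mem_powerset]
      intro i hi
      rcases Finset.mem_insert.1 hi with rfl | hi
      · exact ha
      · rwa [Finset.mem_singleton.1 hi]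
    · intro i hi j _ _ hia hib
      simp [hia, hib] at hi
  obtain ⟨I, hI, hmax⟩ := Finset.exists_max_image _ Finset.card hne
  obtain ⟨hIs, haI, hbI, hgood⟩ := Finset.mem_filter.1 hI
  rw [Finset.mem_powerset] at hIs
  refine ⟨I, hIs, haI, hbI, hgood, fun j hj => ?_⟩
  obtain ⟨hjs, hjI⟩ := Finset.mem_sdiff.1 hj
  by_contra! hno
  have hins : insert j I ∈ s.powerset.filter good := by
    refine Finset.mem_filter.2 ⟨?_, Finset.mem_insert_of_mem haI, Finset.mem_insert_of_mem hbI, ?_⟩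
    · exact Finset.mem_powerset.2 (Finset.insert_subset hjs hIs)
    · intro i hi l hl hil hia hib
      rcases Finset.mem_insert.1 hi with rfl | hi' <;>
        rcases Finset.mem_insert.1 hl with rfl | hl'
      · exact absurd rfl hil
      · exact hno l hl'
      · exact fun h => hno i hi' (hR _ _ h)
      · exact hgood i hi' l hl' hil hia hib
  have := hmax _ hins
  rw [Finset.card_insert_of_notMem hjI] at this
  omega

section Isolated

variable {E ι : Type*} [NormedAddCommGroup E] [MeasurableSpace E]

/-- The nearest neighbour ball of `x i` has `μ`-probability larger than `t`, expressed by
distances. -/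
def Isolated (μ : Measure E) (t : ℝ) (x : ι → E) (i : ι) : Prop :=
  ∀ j, j ≠ i → quantileRadius μ t (x i) < ‖x i - x j‖

variable {μ : Measure E} {β C t : ℝ}

lemma separated_update [DecidableEq ι] {s : Finset ι} {j : ι} (hj : j ∉ s) (x : ι → E) (u : E) :
    Separated μ t s (Function.update x j u) ↔ Separated μ t s x := by
  refine forall₂_congr fun i hi => forall₂_congr fun l hl => ?_
  rw [Function.update_of_ne (ne_of_mem_of_not_mem hi hj),
    Function.update_of_ne (ne_of_mem_of_not_mem hl hj)]

lemma ballUnion_update [DecidableEq ι] {s : Finset ι} {j : ι} (hj : j ∉ s) (x : ι → E) (u : E) :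
    ballUnion μ t s (Function.update x j u) = ballUnion μ t s x := by
  refine Set.iUnion₂_congr fun i hi => ?_
  rw [Function.update_of_ne (ne_of_mem_of_not_mem hi hj)]

lemma forall_isolated_iff [Fintype ι] [DecidableEq ι] {s : Finset ι} {x : ι → E} :
    (∀ i ∈ s, Isolated μ t x i) ↔
      Separated μ t s x ∧ ∀ j ∈ sᶜ, x j ∈ (ballUnion μ t s x)ᶜ := by
  simp only [Set.mem_compl_iff, mem_ballUnion, not_exists, not_and, not_le, Finset.mem_compl]
  constructor
  · intro h
    exact ⟨fun i hi j _ hji => h i hi j hji,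
      fun j hj i hi => h i hi j fun hji => hj (hji ▸ hi)⟩
  · rintro ⟨h1, h2⟩ i hi j hji
    by_cases hj : j ∈ s
    · exact h1 i hi j hj hji
    · exact h2 j hj i hi

variable [BorelSpace E] [IsProbabilityMeasure μ]

lemma measure_compl_ballUnion_pow_le {s : Finset ι} {x : ι → E} {c : ℝ} (N : ℕ)
    (h : c ≤ μ.real (ballUnion μ t s x)) :
    μ (ballUnion μ t s x)ᶜ ^ N ≤ ENNReal.ofReal (Real.exp (-(c * N))) := by
  have hU : MeasurableSet (ballUnion μ t s x) :=
    Finset.measurableSet_biUnion _ fun i _ => measurableSet_closedBall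
  have : μ (ballUnion μ t s x)ᶜ ≤ ENNReal.ofReal (Real.exp (-c)) := by
    rw [← ofReal_measureReal, probReal_compl_eq_one_sub hU]
    refine ENNReal.ofReal_le_ofReal ?_
    have := Real.add_one_le_exp (-c)
    linarith
  refine (pow_le_pow_left₀ bot_le this N).trans (le_of_eq ?_)
  rw [← ENNReal.ofReal_pow (Real.exp_pos _).le, ← Real.exp_nat_mul]
  ring_nf

/-- The pairs of distinct elements of `s` together with a subset of `s` that contains them. -/
def linkPatterns [DecidableEq ι] (s : Finset ι) : Finset (ι × ι × Finset ι) :=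
  (s ×ˢ s ×ˢ s.powerset).filter fun p => p.1 ≠ p.2.1 ∧ p.1 ∈ p.2.2 ∧ p.2.1 ∈ p.2.2

/-- Either the balls around the points with index in `s` are disjoint, or they contain one of
finitely many patterns of overlapping balls which still cover a large probability. -/
lemma indicator_separated_mul_le [DecidableEq ι] (hμ : ∀ x r, μ (Metric.sphere x r) = 0)
    (ht0 : 0 < t) (ht1 : t < 1) (hcond : BallCondition μ β C t) (s : Finset ι) {x : ι → E}
    (hx : ∀ i, x i ∈ μ.support) (N : ℕ) :
    {x : ι → E | Separated μ t s x}.indicator (fun _ => 1) x * μ (ballUnion μ t s x)ᶜ ^ N ≤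
      ENNReal.ofReal (Real.exp (-(s.card * t * N))) + ∑ p ∈ linkPatterns s,
        ENNReal.ofReal (Real.exp (-((p.2.2.card - β) * t * N))) *
        ({x : ι → E | Linked μ t (x p.1) (x p.2.1)}.indicator (fun _ => 1) x *
          ∏ j ∈ s \ p.2.2, {u | ∃ i ∈ p.2.2, Linked μ t u (x i)}.indicator (fun _ => 1) (x j)) := by
  classical
  by_cases hsep : Separated μ t s x
  swap
  · simp [Set.indicator_apply, hsep]
  have e1 : {x : ι → E | Separated μ t s x}.indicator (fun _ => (1 : ENNReal)) x = 1 :=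
    Set.indicator_of_mem hsep _
  rw [e1, one_mul]
  by_cases hl : ∀ i ∈ s, ∀ j ∈ s, i ≠ j → ¬ Linked μ t (x i) (x j)
  · refine le_add_of_le_left (measure_compl_ballUnion_pow_le N ?_)
    exact (measureReal_ballUnion_of_not_linked hμ ht0 ht1 hx hsep hl).ge
  push Not at hl
  obtain ⟨a, ha, b, hb, hab, hlab⟩ := hl
  obtain ⟨I, hIs, haI, hbI, hgood, hdom⟩ := exists_maximal_unlinked
    (R := fun i j => Linked μ t (x i) (x j)) (fun _ _ h => h.symm) ha hb
  have hp : (a, b, I) ∈ linkPatterns s := by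
    simp only [linkPatterns, Finset.mem_filter, Finset.mem_product, Finset.mem_powerset]
    exact ⟨⟨ha, hb, hIs⟩, hab, haI, hbI⟩
  refine le_add_of_le_right (le_trans ?_ (Finset.single_le_sum (fun _ _ => bot_le) hp))
  rw [prod_indicator_one_eq_ite, if_pos (by exact hdom)]
  rw [Set.indicator_of_mem (by exact hlab), mul_one, mul_one]
  refine measure_compl_ballUnion_pow_le N ?_
  refine (le_measureReal_ballUnion hμ ht0 ht1 hcond hx (hsep.mono hIs) haI hbI hab hgood).trans ?_
  exact measureReal_mono (Set.biUnion_subset_biUnion_left hIs)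

variable [SecondCountableTopology E]

lemma measurableSet_quantileRadius_lt (hμ : ∀ x r, μ (Metric.sphere x r) = 0)
    (ht0 : 0 < t) (ht1 : t < 1) (i j : ι) :
    MeasurableSet {x : ι → E | quantileRadius μ t (x i) < ‖x i - x j‖} :=
  measurableSet_lt ((measurable_quantileRadius hμ ht0 ht1).comp (measurable_pi_apply i))
    (by fun_prop)

lemma measurableSet_separated [Countable ι] (hμ : ∀ x r, μ (Metric.sphere x r) = 0)
    (ht0 : 0 < t) (ht1 : t < 1) (s : Finset ι) :
    MeasurableSet {x : ι → E | Separated μ t s x} := by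
  simp only [Separated, Set.ofPred_forall]
  exact .iInter fun i => .iInter fun _ => .iInter fun j => .iInter fun _ => .iInter fun _ =>
    measurableSet_quantileRadius_lt hμ ht0 ht1 i j

lemma measurableSet_isolated [Countable ι] (hμ : ∀ x r, μ (Metric.sphere x r) = 0)
    (ht0 : 0 < t) (ht1 : t < 1) (i : ι) :
    MeasurableSet {x : ι → E | Isolated μ t x i} := by
  simp only [Isolated, Set.ofPred_forall]
  exact .iInter fun j => .iInter fun _ => measurableSet_quantileRadius_lt hμ ht0 ht1 i j

lemma measurableSet_linked_apply (hμ : ∀ x r, μ (Metric.sphere x r) = 0)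
    (ht0 : 0 < t) (ht1 : t < 1) (i j : ι) :
    MeasurableSet {x : ι → E | Linked μ t (x i) (x j)} := by
  have hf : Measurable fun x : ι → E => (x i, x j) :=
    (measurable_pi_apply i).prodMk (measurable_pi_apply j)
  exact hf (measurableSet_linked hμ ht0 ht1)

lemma measurableSet_mem_ballUnion (hμ : ∀ x r, μ (Metric.sphere x r) = 0)
    (ht0 : 0 < t) (ht1 : t < 1) (s : Finset ι) :
    MeasurableSet {p : (ι → E) × E | p.2 ∈ ballUnion μ t s p.1} := by
  have : {p : (ι → E) × E | p.2 ∈ ballUnion μ t s p.1} =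
      ⋃ i ∈ s, {p : (ι → E) × E | ‖p.1 i - p.2‖ ≤ quantileRadius μ t (p.1 i)} := by
    ext p
    simp [mem_ballUnion]
  rw [this]
  refine Finset.measurableSet_biUnion _ fun i _ => measurableSet_le (by fun_prop) ?_
  exact (measurable_quantileRadius hμ ht0 ht1).comp ((measurable_pi_apply i).comp measurable_fst)

variable [Fintype ι] [DecidableEq ι]

/-- Given separated points with index in `s`, the other points avoid the union of their balls
independently of each other. -/
lemma measure_forall_isolated (hμ : ∀ x r, μ (Metric.sphere x r) = 0) (ht0 : 0 < t) (ht1 : t < 1)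
    (s : Finset ι) :
    Measure.pi (fun _ => μ) {x : ι → E | ∀ i ∈ s, Isolated μ t x i} =
      ∫⁻ x, {x : ι → E | Separated μ t s x}.indicator (fun _ => 1) x *
        μ (ballUnion μ t s x)ᶜ ^ sᶜ.card ∂(Measure.pi fun _ => μ) := by
  classical
  have hsep := measurableSet_separated (ι := ι) hμ ht0 ht1 s
  have hU := measurableSet_mem_ballUnion (ι := ι) hμ ht0 ht1 s
  rw [← lintegral_mul_prod_indicator (V := fun x => (ballUnion μ t s x)ᶜ) hU.compl sᶜ
    (fun j hj x u => by rw [ballUnion_update (Finset.mem_compl.1 hj)])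
    (measurable_const.indicator hsep)
    fun j hj x u => by
      simp only [Set.indicator_apply, Set.mem_ofPred_eq, separated_update (Finset.mem_compl.1 hj)]]
  have hm : MeasurableSet {x : ι → E | ∀ i ∈ s, Isolated μ t x i} := by
    simp only [Set.ofPred_forall]
    exact .iInter fun i => .iInter fun _ => measurableSet_isolated hμ ht0 ht1 i
  rw [← lintegral_indicator_one hm]
  refine lintegral_congr fun x => ?_
  rw [prod_indicator_one_eq_ite]
  simp only [Set.indicator_apply, Set.mem_ofPred_eq, forall_isolated_iff, Pi.one_apply]
  by_cases h1 : Separated μ t s x <;> simp [h1]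

/-- A pair `a`, `b` of linked points and further points that are each linked to one of the points
with index in `I` have a probability of the expected order of magnitude. -/
lemma lintegral_linked_mul_prod_le (hμ : ∀ x r, μ (Metric.sphere x r) = 0)
    (ht0 : 0 < t) (ht1 : t < 1) {κ : ENNReal} (hκ : ∀ z, μ {x | Linked μ t x z} ≤ κ)
    {I J : Finset ι} (hIJ : Disjoint I J) {a b : ι} (ha : a ∈ I) (hb : b ∈ I) (hab : a ≠ b) :
    ∫⁻ x : ι → E, {x : ι → E | Linked μ t (x a) (x b)}.indicator (fun _ => 1) x *
      ∏ j ∈ J, {u | ∃ i ∈ I, Linked μ t u (x i)}.indicator (fun _ => 1) (x j)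
        ∂(Measure.pi fun _ => μ) ≤ κ * (I.card * κ) ^ J.card := by
  classical
  have hL := measurableSet_linked (μ := μ) hμ ht0 ht1
  have hnot : ∀ {i j}, i ∈ I → j ∈ J → i ≠ j := fun hi hj h =>
    Finset.disjoint_left.1 hIJ hi (h ▸ hj)
  have hLab := measurableSet_linked_apply hμ ht0 ht1 a b
  have hV : MeasurableSet {p : (ι → E) × E | p.2 ∈ {u | ∃ i ∈ I, Linked μ t u (p.1 i)}} := by
    have : {p : (ι → E) × E | p.2 ∈ {u | ∃ i ∈ I, Linked μ t u (p.1 i)}} =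
        ⋃ i ∈ I, {p : (ι → E) × E | Linked μ t p.2 (p.1 i)} := by
      ext p
      simp
    rw [this]
    refine Finset.measurableSet_biUnion _ fun i _ => ?_
    have hf : Measurable fun p : (ι → E) × E => (p.2, p.1 i) :=
      measurable_snd.prodMk ((measurable_pi_apply i).comp measurable_fst)
    exact hf hL
  have hVle : ∀ x : ι → E, μ {u | ∃ i ∈ I, Linked μ t u (x i)} ≤ I.card * κ := by
    intro x
    have : {u | ∃ i ∈ I, Linked μ t u (x i)} = ⋃ i ∈ I, {u | Linked μ t u (x i)} := by
      ext u
      simp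
    rw [this]
    refine (measure_biUnion_finset_le _ _).trans ?_
    refine (Finset.sum_le_sum fun i _ => hκ (x i)).trans (le_of_eq ?_)
    simp
  have hpair : ∫⁻ x : ι → E, {x : ι → E | Linked μ t (x a) (x b)}.indicator (fun _ => 1) x
      ∂(Measure.pi fun _ => μ) ≤ κ := by
    rw [lintegral_pi_eq_lintegral_update (measurable_const.indicator hLab) a]
    have : ∀ x : ι → E, ∫⁻ u, {x : ι → E | Linked μ t (x a) (x b)}.indicator (fun _ => 1)
        (Function.update x a u) ∂μ ≤ κ := by
      intro x
      refine le_trans (le_of_eq ?_) (hκ (x b))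
      have hx : MeasurableSet {u | Linked μ t u (x b)} :=
        (measurable_id.prodMk measurable_const) hL
      rw [← lintegral_indicator_one hx]
      refine lintegral_congr fun u => ?_
      simp only [Set.indicator_apply, Set.mem_ofPred_eq, Function.update_self,
        Function.update_of_ne hab.symm, Pi.one_apply]
    refine (lintegral_mono this).trans ?_
    simp
  rw [lintegral_mul_prod_indicator hV J
    (fun j hj x u => by
      ext v
      simp only [Set.mem_ofPred_eq]
      refine exists_congr fun i => and_congr_right fun hi => ?_
      rw [Function.update_of_ne (hnot hi hj)])
    (measurable_const.indicator hLab)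
    fun j hj x u => by
      simp only [Set.indicator_apply, Set.mem_ofPred_eq, Function.update_of_ne (hnot ha hj),
        Function.update_of_ne (hnot hb hj)]]
  calc ∫⁻ x : ι → E, {x : ι → E | Linked μ t (x a) (x b)}.indicator (fun _ => 1) x *
        μ {u | ∃ i ∈ I, Linked μ t u (x i)} ^ J.card ∂(Measure.pi fun _ => μ)
      ≤ ∫⁻ x : ι → E, {x : ι → E | Linked μ t (x a) (x b)}.indicator (fun _ => 1) x *
        (I.card * κ) ^ J.card ∂(Measure.pi fun _ => μ) :=
        lintegral_mono fun x => by gcongr; exact hVle x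
    _ ≤ κ * (I.card * κ) ^ J.card := by
        rw [lintegral_mul_const _ (measurable_const.indicator hLab)]
        gcongr

/-- The upper bound for the joint probability: the first term comes from disjoint balls, the sum
from overlapping ones. -/
lemma measure_forall_isolated_le (hμ : ∀ x r, μ (Metric.sphere x r) = 0)
    (ht0 : 0 < t) (ht1 : t < 1) (hcond : BallCondition μ β C t) {κ : ENNReal}
    (hκ : ∀ z, μ {x | Linked μ t x z} ≤ κ) (s : Finset ι) :
    Measure.pi (fun _ => μ) {x : ι → E | ∀ i ∈ s, Isolated μ t x i} ≤
      ENNReal.ofReal (Real.exp (-(s.card * t * sᶜ.card))) + ∑ p ∈ linkPatterns s,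
        ENNReal.ofReal (Real.exp (-((p.2.2.card - β) * t * sᶜ.card))) *
          (κ * (p.2.2.card * κ) ^ (s \ p.2.2).card) := by
  rw [measure_forall_isolated hμ ht0 ht1]
  have hsupp : ∀ᵐ x ∂(Measure.pi fun _ : ι => μ), ∀ i, x i ∈ μ.support :=
    ae_all_iff.2 fun i =>
      (measurePreserving_eval (fun _ : ι => μ) i).quasiMeasurePreserving.ae
        Measure.support_mem_ae
  have hmeas : ∀ p : ι × ι × Finset ι, Measurable fun x : ι → E =>
      {x : ι → E | Linked μ t (x p.1) (x p.2.1)}.indicator (fun _ => (1 : ENNReal)) x *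
        ∏ j ∈ s \ p.2.2, {u | ∃ i ∈ p.2.2, Linked μ t u (x i)}.indicator
          (fun _ => (1 : ENNReal)) (x j) := by
    intro p
    refine (measurable_const.indicator (measurableSet_linked_apply hμ ht0 ht1 _ _)).mul
      (Finset.measurable_fun_prod _ fun j _ => ?_)
    have hset : MeasurableSet {x : ι → E | ∃ i ∈ p.2.2, Linked μ t (x j) (x i)} := by
      have : {x : ι → E | ∃ i ∈ p.2.2, Linked μ t (x j) (x i)} =
          ⋃ i ∈ p.2.2, {x : ι → E | Linked μ t (x j) (x i)} := by
        ext x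
        simp
      rw [this]
      exact Finset.measurableSet_biUnion _ fun i _ =>
        measurableSet_linked_apply hμ ht0 ht1 j i
    exact (measurable_const (a := (1 : ENNReal))).indicator hset
  refine (lintegral_mono_ae (hsupp.mono fun x hx =>
    indicator_separated_mul_le hμ ht0 ht1 hcond s hx sᶜ.card)).trans ?_
  rw [lintegral_add_left measurable_const, lintegral_const, measure_univ, mul_one,
    lintegral_finsetSum _ fun p _ => (hmeas p).const_mul _]
  gcongr with p hp
  rw [lintegral_const_mul _ (hmeas p)]
  gcongr
  obtain ⟨-, hab, ha, hb⟩ := Finset.mem_filter.1 hp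
  exact lintegral_linked_mul_prod_le hμ ht0 ht1 hκ Finset.disjoint_sdiff ha hb hab

lemma measure_not_separated_le (hμ : ∀ x r, μ (Metric.sphere x r) = 0)
    (ht0 : 0 < t) (ht1 : t < 1) (s : Finset ι) :
    Measure.pi (fun _ => μ) {x : ι → E | Separated μ t s x}ᶜ ≤
      ENNReal.ofReal (s.card ^ 2 * t) := by
  classical
  have hone : ∀ i j : ι, j ≠ i →
      Measure.pi (fun _ => μ) {x : ι → E | ‖x i - x j‖ ≤ quantileRadius μ t (x i)} =
        ENNReal.ofReal t := by
    intro i j hji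
    have hm : MeasurableSet {x : ι → E | ‖x i - x j‖ ≤ quantileRadius μ t (x i)} :=
      measurableSet_le (by fun_prop)
        ((measurable_quantileRadius hμ ht0 ht1).comp (measurable_pi_apply i))
    rw [← lintegral_indicator_one hm,
      lintegral_pi_eq_lintegral_update (measurable_one.indicator hm) j]
    have : ∀ x : ι → E, ∫⁻ u, {x : ι → E | ‖x i - x j‖ ≤ quantileRadius μ t (x i)}.indicator 1
        (Function.update x j u) ∂μ = ENNReal.ofReal t := by
      intro x
      conv_rhs => rw [← measureReal_closedBall_quantileRadius hμ ht0 ht1 (x i)]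
      rw [ofReal_measureReal, ← lintegral_indicator_one measurableSet_closedBall]
      refine lintegral_congr fun u => ?_
      simp only [Set.indicator_apply, Set.mem_ofPred_eq, Function.update_self,
        Function.update_of_ne hji.symm, Metric.mem_closedBall, dist_eq_norm, norm_sub_rev u,
        Pi.one_apply]
    simp_rw [this]
    simp
  have hsub : {x : ι → E | Separated μ t s x}ᶜ ⊆
      ⋃ p ∈ (s ×ˢ s).filter fun p => p.2 ≠ p.1,
        {x : ι → E | ‖x p.1 - x p.2‖ ≤ quantileRadius μ t (x p.1)} := by
    intro x hx
    simp only [Set.mem_compl_iff, Set.mem_ofPred_eq, Separated] at hx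
    push Not at hx
    obtain ⟨i, hi, j, hj, hji, h⟩ := hx
    refine Set.mem_iUnion₂.2 ⟨(i, j), ?_, h⟩
    simp [hi, hj, hji]
  refine (measure_mono hsub).trans ((measure_biUnion_finset_le _ _).trans ?_)
  rw [Finset.sum_congr rfl fun p hp => hone p.1 p.2 (Finset.mem_filter.1 hp).2, Finset.sum_const,
    nsmul_eq_mul, ENNReal.ofReal_mul (by positivity)]
  gcongr
  rw [← Nat.cast_pow, ENNReal.ofReal_natCast]
  refine Nat.cast_le.2 ((Finset.card_filter_le _ _).trans ?_)
  rw [Finset.card_product, sq]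

lemma le_measure_forall_isolated (hμ : ∀ x r, μ (Metric.sphere x r) = 0)
    (ht0 : 0 < t) (ht1 : t < 1) (s : Finset ι) (hs : s.card * t ≤ 1) :
    ENNReal.ofReal ((1 - s.card ^ 2 * t) * (1 - s.card * t) ^ sᶜ.card) ≤
      Measure.pi (fun _ => μ) {x : ι → E | ∀ i ∈ s, Isolated μ t x i} := by
  have hsep := measurableSet_separated (ι := ι) hμ ht0 ht1 s
  have hball : ∀ x : ι → E, ENNReal.ofReal (1 - s.card * t) ≤ μ (ballUnion μ t s x)ᶜ := by
    intro x
    have hU : MeasurableSet (ballUnion μ t s x) :=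
      Finset.measurableSet_biUnion _ fun i _ => measurableSet_closedBall
    rw [← ofReal_measureReal, probReal_compl_eq_one_sub hU]
    refine ENNReal.ofReal_le_ofReal ?_
    linarith [measureReal_ballUnion_le hμ ht0 ht1 s x]
  have hQ : ENNReal.ofReal (1 - s.card ^ 2 * t) ≤
      Measure.pi (fun _ => μ) {x : ι → E | Separated μ t s x} := by
    rw [ENNReal.ofReal_sub _ (by positivity), ENNReal.ofReal_one, tsub_le_iff_right,
      ← prob_add_prob_compl (μ := Measure.pi fun _ : ι => μ) hsep]
    gcongr
    exact measure_not_separated_le hμ ht0 ht1 s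
  rw [measure_forall_isolated hμ ht0 ht1, mul_comm,
    ENNReal.ofReal_mul (pow_nonneg (sub_nonneg.2 hs) _), mul_comm,
    ENNReal.ofReal_pow (sub_nonneg.2 hs)]
  calc ENNReal.ofReal (1 - s.card ^ 2 * t) * ENNReal.ofReal (1 - s.card * t) ^ sᶜ.card
      ≤ Measure.pi (fun _ => μ) {x : ι → E | Separated μ t s x} *
        ENNReal.ofReal (1 - s.card * t) ^ sᶜ.card := by gcongr
    _ = ∫⁻ x, {x : ι → E | Separated μ t s x}.indicator (fun _ => 1) x *
        ENNReal.ofReal (1 - s.card * t) ^ sᶜ.card ∂(Measure.pi fun _ => μ) := by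
        rw [lintegral_mul_const _ (measurable_const.indicator hsep)]
        congr 1
        exact (lintegral_indicator_one hsep).symm
    _ ≤ _ := lintegral_mono fun x => by gcongr; exact hball x

end Isolated

/-! ### Nearest neighbour balls with large probability -/

section NearestNeighbour

variable {d n : ℕ} {μ : Measure (EuclideanSpace ℝ (Fin d))} {y : ℝ}

/-- No nearest neighbour ball exceeds the level if and only if the largest one does not. -/
lemma nnExceedances_eq_zero_iff (hn : n ≠ 0) (x : Fin n → EuclideanSpace ℝ (Fin d)) :
    nnExceedances μ y x = 0 ↔ n * maxNNBallProb μ x - Real.log n ≤ y := by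
  have : NeZero n := ⟨hn⟩
  have hn0 : (0 : ℝ) < n := by positivity
  rw [nnExceedances, Finset.sum_eq_zero_iff, sub_le_iff_le_add, ← le_div_iff₀' hn0, maxNNBallProb,
    ciSup_le_iff (Set.finite_range _).bddAbove]
  simp [Set.indicator_apply, le_div_iff₀' hn0]

lemma nnExceedances_le (x : Fin n → EuclideanSpace ℝ (Fin d)) : nnExceedances μ y x ≤ n := by
  refine (Finset.sum_le_card_nsmul _ _ 1 fun i _ => ?_).trans (by simp)
  exact Set.indicator_le_self' (fun _ _ => zero_le) _

variable [IsProbabilityMeasure μ]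

lemma measurable_nnBallProb (i : Fin n) :
    Measurable fun x : Fin n → EuclideanSpace ℝ (Fin d) => nnBallProb μ x i := by
  have hr : Measurable fun x : Fin n → EuclideanSpace ℝ (Fin d) => nnRadius x i :=
    Measurable.iInf fun j => ((measurable_pi_apply i).sub (measurable_pi_apply j.1)).norm
  have hp : Measurable fun x : Fin n → EuclideanSpace ℝ (Fin d) => (x i, nnRadius x i) :=
    (measurable_pi_apply i).prodMk hr
  simpa only [nnBallProb, Function.comp_def] using
    (measurable_measureReal_closedBall (μ := μ)).comp hp

lemma measurable_nnExceedances :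
    Measurable fun x : Fin n → EuclideanSpace ℝ (Fin d) => nnExceedances μ y x :=
  Finset.measurable_fun_sum _ fun i _ =>
    (measurable_const.indicator measurableSet_Ioi).comp ((measurable_nnBallProb i).const_mul _)

lemma lt_nnBallProb_iff (hμ : ∀ x r, μ (Metric.sphere x r) = 0) {t : ℝ} (ht0 : 0 < t)
    (ht1 : t < 1) (hn : 2 ≤ n) (x : Fin n → EuclideanSpace ℝ (Fin d)) (i : Fin n) :
    t < nnBallProb μ x i ↔ Isolated μ t x i := by
  rw [nnBallProb, ← quantileRadius_lt_iff hμ ht0 ht1]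
  have : Nontrivial (Fin n) := Fin.nontrivial_iff_two_le.2 hn
  have : Nonempty {j : Fin n // j ≠ i} := let ⟨j, hj⟩ := exists_ne i; ⟨⟨j, hj⟩⟩
  constructor
  · intro h j hj
    exact h.trans_le (ciInf_le (Set.finite_range _).bddBelow (⟨j, hj⟩ : {j : Fin n // j ≠ i}))
  · intro h
    obtain ⟨j, hj⟩ := exists_eq_ciInf_of_finite (f := fun j : {j : Fin n // j ≠ i} => ‖x i - x j‖)
    rw [nnRadius, ← hj]
    exact h j j.2

open Classical in
lemma nnExceedances_eq_card (hμ : ∀ x r, μ (Metric.sphere x r) = 0) (ht0 : 0 < level y n)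
    (ht1 : level y n < 1) (hn : 2 ≤ n) (x : Fin n → EuclideanSpace ℝ (Fin d)) :
    nnExceedances μ y x = (Finset.univ.filter fun i => Isolated μ (level y n) x i).card := by
  rw [nnExceedances, Finset.card_filter]
  refine Finset.sum_congr rfl fun i _ => ?_
  have hn0 : (0 : ℝ) < n := by positivity
  rw [Set.indicator_apply]
  refine if_congr ?_ rfl rfl
  rw [← lt_nnBallProb_iff hμ ht0 ht1 hn, level, Set.mem_Ioi, div_lt_iff₀' hn0]

open Classical in
lemma choose_card_filter {ι : Type*} [Fintype ι] (p : ι → Prop) (k : ℕ) :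
    ((Finset.univ.filter p).card.choose k : ℝ) =
      ∑ s ∈ Finset.univ.powersetCard k, if ∀ i ∈ s, p i then (1 : ℝ) else 0 := by
  rw [← Finset.card_powersetCard, ← Finset.sum_filter, Finset.sum_const, nsmul_one]
  congr 2
  ext s
  simp only [Finset.mem_powersetCard, Finset.mem_filter, true_and,
    Finset.subset_iff, Finset.mem_univ]
  tauto

/-- The binomial moments of the number of exceedances are sums of joint probabilities. -/
lemma integral_choose_nnExceedances (hμ : ∀ x r, μ (Metric.sphere x r) = 0) (ht0 : 0 < level y n)
    (ht1 : level y n < 1) (hn : 2 ≤ n) (k : ℕ) :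
    ∫ x : Fin n → EuclideanSpace ℝ (Fin d), ((nnExceedances μ y x).choose k : ℝ)
        ∂(Measure.pi fun _ => μ) =
      ∑ s ∈ (Finset.univ : Finset (Fin n)).powersetCard k, (Measure.pi fun _ => μ).real
        {x : Fin n → EuclideanSpace ℝ (Fin d) | ∀ i ∈ s, Isolated μ (level y n) x i} := by
  classical
  have hm : ∀ s : Finset (Fin n), MeasurableSet
      {x : Fin n → EuclideanSpace ℝ (Fin d) | ∀ i ∈ s, Isolated μ (level y n) x i} := by
    intro s
    simp only [Set.ofPred_forall]
    exact .iInter fun i => .iInter fun _ => measurableSet_isolated hμ ht0 ht1 i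
  have hint : ∀ s : Finset (Fin n), Integrable (fun x : Fin n → EuclideanSpace ℝ (Fin d) =>
      if ∀ i ∈ s, Isolated μ (level y n) x i then (1 : ℝ) else 0) (Measure.pi fun _ => μ) := by
    intro s
    refine Integrable.of_bound (C := 1) ?_ (Eventually.of_forall fun x => by split_ifs <;> simp)
    exact (Measurable.ite (hm s) measurable_const measurable_const).aestronglyMeasurable
  simp_rw [nnExceedances_eq_card hμ ht0 ht1 hn, choose_card_filter]
  refine (integral_finsetSum _ fun s _ => by convert hint s).trans ?_
  refine Finset.sum_congr rfl fun s _ => ?_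
  rw [← integral_indicator_one (hm s)]
  exact integral_congr_ae (Eventually.of_forall fun x => by simp [Set.indicator_apply])

/-- An upper bound for the joint probability of `k` exceedances in terms of the level alone. -/
lemma measureReal_forall_isolated_le {ι : Type*} [Fintype ι] [DecidableEq ι]
    (hμ : ∀ x r, μ (Metric.sphere x r) = 0) {β C t : ℝ} (hC : 0 ≤ C)
    (ht0 : 0 < t) (ht1 : t < 1) (hcond : BallCondition μ β C t) {K : ℕ}
    (hK : ∀ (z : EuclideanSpace ℝ (Fin d)) (c : ℝ),
      μ {x | μ.real (Metric.closedBall x ‖x - z‖) ≤ c} ≤ K * ENNReal.ofReal c)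
    {k : ℕ} {s : Finset ι} (hs : s.card = k) :
    (Measure.pi fun _ => μ).real
        {x : ι → EuclideanSpace ℝ (Fin d) | ∀ i ∈ s, Isolated μ t x i} ≤
      Real.exp (-(k * t * (Fintype.card ι - k))) + (k * (k * 2 ^ k) : ℕ) *
        ∑ m ∈ Finset.Icc 1 k, (K + 1) * C * (m * ((K + 1) * C)) ^ (k - m) *
          (t ^ (k + 1 - m) * Real.exp (-((m - β) * t * (Fintype.card ι - k)))) := by
  set A : ℝ := (K + 1) * C with hA
  have hA0 : 0 ≤ A := by positivity
  set G : ℕ → ℝ := fun m => A * (m * A) ^ (k - m) *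
    (t ^ (k + 1 - m) * Real.exp (-((m - β) * t * (Fintype.card ι - k)))) with hG
  have hG0 : ∀ m, 0 ≤ G m := fun m => by positivity
  have hcompl : (sᶜ.card : ℝ) = Fintype.card ι - k := by
    rw [Finset.card_compl, Nat.cast_sub (Finset.card_le_univ s), hs]
  have h := measure_forall_isolated_le hμ ht0 ht1 hcond
    (fun z => measure_linked_le hK hcond z) s
  have hκ : ((K : ENNReal) + 1) * ENNReal.ofReal (C * t) = ENNReal.ofReal (A * t) := by
    rw [hA, mul_assoc, ENNReal.ofReal_mul (p := (K : ℝ) + 1) (by positivity),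
      ENNReal.ofReal_add (by positivity) zero_le_one, ENNReal.ofReal_natCast, ENNReal.ofReal_one]
  have hterm : ∀ p ∈ linkPatterns s,
      ENNReal.ofReal (Real.exp (-((p.2.2.card - β) * t * sᶜ.card))) *
        (ENNReal.ofReal (A * t) * (p.2.2.card * ENNReal.ofReal (A * t)) ^ (s \ p.2.2).card) ≤
      ENNReal.ofReal (∑ m ∈ Finset.Icc 1 k, G m) := by
    intro p hp
    obtain ⟨hps, -, ha, -⟩ := Finset.mem_filter.1 hp
    have hI : p.2.2 ⊆ s :=
      Finset.mem_powerset.1 (Finset.mem_product.1 (Finset.mem_product.1 hps).2).2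
    have hIk : p.2.2.card ≤ k := hs ▸ Finset.card_le_card hI
    have hI1 : 1 ≤ p.2.2.card := Finset.card_pos.2 ⟨_, ha⟩
    rw [Finset.card_sdiff_of_subset hI, hs, hcompl, ← ENNReal.ofReal_natCast,
      ← ENNReal.ofReal_mul (by positivity), ← ENNReal.ofReal_pow (by positivity),
      ← ENNReal.ofReal_mul (by positivity), ← ENNReal.ofReal_mul (by positivity)]
    refine ENNReal.ofReal_le_ofReal (le_trans (le_of_eq ?_) (Finset.single_le_sum
      (fun m _ => hG0 m) (Finset.mem_Icc.2 ⟨hI1, hIk⟩)))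
    simp only [hG]
    rw [show k + 1 - p.2.2.card = k - p.2.2.card + 1 by omega]
    simp only [pow_succ, mul_pow]
    ring
  rw [hκ] at h
  have hcard : (linkPatterns s).card ≤ k * (k * 2 ^ k) := by
    refine (Finset.card_filter_le _ _).trans ?_
    rw [Finset.card_product, Finset.card_product, Finset.card_powerset, hs]
  have hS0 : 0 ≤ ∑ m ∈ Finset.Icc 1 k, G m := Finset.sum_nonneg fun m _ => hG0 m
  rw [measureReal_def]
  refine ENNReal.toReal_le_of_le_ofReal (by positivity) (h.trans ?_)
  rw [ENNReal.ofReal_add (Real.exp_pos _).le (by positivity), hs, hcompl,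
    ENNReal.ofReal_mul (p := ((k * (k * 2 ^ k) : ℕ) : ℝ)) (by positivity), ENNReal.ofReal_natCast]
  gcongr
  refine (Finset.sum_le_card_nsmul _ _ _ (by rw [← hcompl]; exact hterm)).trans ?_
  rw [nsmul_eq_mul]
  gcongr

lemma le_measureReal_forall_isolated {ι : Type*} [Fintype ι] [DecidableEq ι]
    (hμ : ∀ x r, μ (Metric.sphere x r) = 0) {t : ℝ}
    (ht0 : 0 < t) (ht1 : t < 1) {k : ℕ} {s : Finset ι} (hs : s.card = k) (hkt : k * t ≤ 1) :
    (1 - k ^ 2 * t) * (1 - k * t) ^ (Fintype.card ι - k) ≤ (Measure.pi fun _ => μ).real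
        {x : ι → EuclideanSpace ℝ (Fin d) | ∀ i ∈ s, Isolated μ t x i} := by
  have h := le_measure_forall_isolated hμ ht0 ht1 s (by rwa [hs])
  rw [Finset.card_compl, hs] at h
  rw [measureReal_def]
  exact (ENNReal.ofReal_le_iff_le_toReal (measure_ne_top _ _)).1 h

/-- The binomial moments of the number of exceedances converge to those of the Poisson
distribution. -/
lemma tendsto_integral_choose_nnExceedances (hμ : ∀ x r, μ (Metric.sphere x r) = 0)
    {β C δ : ℝ} (hβ : β < 1) (hC : 0 ≤ C) (hδ : 0 < δ)
    (hcond : ∀ t, 0 < t → t < 1 → t ≤ δ → BallCondition μ β C t) (y : ℝ) (k : ℕ) :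
    Tendsto (fun n => ∫ x : Fin n → EuclideanSpace ℝ (Fin d), ((nnExceedances μ y x).choose k : ℝ)
      ∂(Measure.pi fun _ => μ)) atTop (𝓝 (Real.exp (-y) ^ k / k.factorial)) := by
  obtain ⟨K, hK⟩ := exists_measure_closedBall_le_le (EuclideanSpace ℝ (Fin d))
  obtain ⟨g, hg, hgle⟩ := tendsto_pow_mul_one_sub_level_pow y k
  -- All index sets of size `k` obey the same bounds, and there are about `n ^ k / k!` of them.
  have hlim : Real.exp (-y) ^ k / k.factorial = 1 / k.factorial * Real.exp (-(k * y)) := by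
    rw [← Real.exp_nat_mul, div_eq_mul_inv, one_div, mul_comm, mul_neg]
  rw [hlim]
  have hupper : Tendsto (fun n : ℕ => (n : ℝ) ^ k * (Real.exp (-(k * level y n * (n - k))) +
      (k * (k * 2 ^ k) : ℕ) * ∑ m ∈ Finset.Icc 1 k, (K + 1) * C * (m * ((K + 1) * C)) ^ (k - m) *
        (level y n ^ (k + 1 - m) * Real.exp (-((m - β) * level y n * (n - k))))))
      atTop (𝓝 (Real.exp (-(k * y)))) := by
    have h1 := tendsto_pow_mul_exp_level y k
    have h2 : Tendsto (fun n : ℕ => ((k * (k * 2 ^ k) : ℕ) : ℝ) * ∑ m ∈ Finset.Icc 1 k,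
        (K + 1) * C * (m * ((K + 1) * C)) ^ (k - m) * ((n : ℝ) ^ k *
          (level y n ^ (k + 1 - m) * Real.exp (-((m - β) * level y n * (n - k))))))
        atTop (𝓝 (((k * (k * 2 ^ k) : ℕ) : ℝ) * ∑ m ∈ Finset.Icc 1 k,
          (K + 1) * C * (m * ((K + 1) * C)) ^ (k - m) * 0)) :=
      (tendsto_finsetSum _ fun m hm => (tendsto_pow_mul_level_pow_mul_exp y hβ
        (Finset.mem_Icc.1 hm).1 (Finset.mem_Icc.1 hm).2).const_mul _).const_mul _
    have h3 := h1.add h2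
    simp only [mul_zero, Finset.sum_const_zero, add_zero] at h3
    refine h3.congr fun n => ?_
    rw [mul_add, mul_left_comm ((n : ℝ) ^ k), Finset.mul_sum (a := (n : ℝ) ^ k)]
    congr 3
    ext m
    ring
  have hlevel := tendsto_level y
  have hkt : Tendsto (fun n => (k : ℝ) * level y n) atTop (𝓝 0) := by
    simpa using hlevel.const_mul (k : ℝ)
  refine tendsto_of_tendsto_of_tendsto_of_le_of_le' ((tendsto_choose_div_pow k).mul hg)
    ((tendsto_choose_div_pow k).mul hupper) ?_ ?_
  · filter_upwards [hgle, eventually_level_pos y, hlevel.eventually (gt_mem_nhds one_pos),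
      hkt.eventually (gt_mem_nhds one_pos), eventually_ge_atTop 2] with n hgn ht0 ht1 hkt hn
    have hn0 : (n : ℝ) ^ k ≠ 0 := by positivity
    rw [integral_choose_nnExceedances hμ ht0 ht1 hn]
    have hs : ∀ s ∈ (Finset.univ : Finset (Fin n)).powersetCard k, _ ≤ _ := fun s hs => by
      simpa using le_measureReal_forall_isolated hμ ht0 ht1 (Finset.mem_powersetCard.1 hs).2 hkt.le
    refine le_trans ?_ (Finset.card_nsmul_le_sum _ _ _ hs)
    rw [Finset.card_powersetCard, Finset.card_univ, Fintype.card_fin, nsmul_eq_mul]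
    refine (mul_le_mul_of_nonneg_left hgn (by positivity)).trans (le_of_eq ?_)
    field_simp
  · filter_upwards [eventually_level_pos y, hlevel.eventually (gt_mem_nhds one_pos),
      hlevel.eventually (gt_mem_nhds hδ), eventually_ge_atTop 2] with n ht0 ht1 htδ hn
    have hn0 : (n : ℝ) ^ k ≠ 0 := by positivity
    rw [integral_choose_nnExceedances hμ ht0 ht1 hn]
    have hs : ∀ s ∈ (Finset.univ : Finset (Fin n)).powersetCard k, _ ≤ _ := fun s hs => by
      simpa only [Fintype.card_fin] using measureReal_forall_isolated_le hμ hC ht0 ht1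
        (hcond _ ht0 ht1 htδ.le) (hK μ) (Finset.mem_powersetCard.1 hs).2
    refine (Finset.sum_le_card_nsmul _ _ _ hs).trans (le_of_eq ?_)
    rw [Finset.card_powersetCard, Finset.card_univ, Fintype.card_fin, nsmul_eq_mul]
    field_simp

end NearestNeighbour

/-- The overlap and doubling conditions for arbitrary radii, specialised to the radii of the balls
of probability `t`. -/
lemma ballCondition_of_forall {d : ℕ} {μ : Measure (EuclideanSpace ℝ (Fin d))}
    [IsProbabilityMeasure μ] (hμ : ∀ x r, μ (Metric.sphere x r) = 0) {β cmax δ : ℝ}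
    (hcond : ∀ r s : ℝ, 0 < r → 0 < s → ∀ x ∈ μ.support, ∀ z ∈ μ.support,
      max r s ≤ ‖x - z‖ →
      μ.real (Metric.closedBall x r) = μ.real (Metric.closedBall z s) →
      μ.real (Metric.closedBall z s) ≤ δ →
        μ.real (Metric.closedBall x r ∩ Metric.closedBall z s) / μ.real (Metric.closedBall z s)
          ≤ β ∧
        μ.real (Metric.closedBall z (2 * s)) ≤ cmax * μ.real (Metric.closedBall z s))
    {t : ℝ} (ht0 : 0 < t) (ht1 : t < 1) (htδ : t ≤ δ) : BallCondition μ β (max cmax 0) t := by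
  have h : ∀ x ∈ μ.support, ∀ z ∈ μ.support,
      max (quantileRadius μ t x) (quantileRadius μ t z) ≤ ‖x - z‖ → _ := fun x hx z hz hxz =>
    hcond _ _ (quantileRadius_pos hμ ht0 ht1 x) (quantileRadius_pos hμ ht0 ht1 z) x hx z hz hxz
      (by simp only [measureReal_closedBall_quantileRadius hμ ht0 ht1])
      (by simpa only [measureReal_closedBall_quantileRadius hμ ht0 ht1] using htδ)
  simp only [measureReal_closedBall_quantileRadius hμ ht0 ht1, div_le_iff₀ ht0] at h
  refine ⟨fun x hx z hz hxz => (h x hx z hz hxz).1, fun x hx z hz hxz =>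
    (h x hx z hz hxz).2.trans ?_⟩
  gcongr
  exact le_max_left _ _

theorem theorem2 {d : ℕ} (hd : 1 ≤ d)
    {Ω : Type*} [MeasurableSpace Ω] (P : Measure Ω) [IsProbabilityMeasure P]
    (μ : Measure (EuclideanSpace ℝ (Fin d))) [IsProbabilityMeasure μ]
    (f : EuclideanSpace ℝ (Fin d) → ENNReal) (hf : Measurable f)
    (hμ : μ = (volume : Measure (EuclideanSpace ℝ (Fin d))).withDensity f)
    (X : ℕ → Ω → EuclideanSpace ℝ (Fin d))
    (hX_law : ∀ i, HasLaw (X i) μ P) (hX_indep : iIndepFun X P)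
    (β cmax δ : ℝ) (hβ0 : 0 < β) (hβ1 : β < 1) (hδ : 0 < δ)
    (hcond : ∀ r s : ℝ, 0 < r → 0 < s → ∀ x ∈ μ.support, ∀ z ∈ μ.support,
      max r s ≤ ‖x - z‖ →
      μ.real (Metric.closedBall x r) = μ.real (Metric.closedBall z s) →
      μ.real (Metric.closedBall z s) ≤ δ →
        μ.real (Metric.closedBall x r ∩ Metric.closedBall z s) / μ.real (Metric.closedBall z s) ≤ β ∧
        μ.real (Metric.closedBall z (2 * s)) ≤ cmax * μ.real (Metric.closedBall z s)) :
    (∀ y : ℝ, TendstoInDistribution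
      (fun (n : ℕ) (ω : Ω) => nnExceedances μ y (fun i : Fin n => X i ω)) atTop
      (id : ℕ → ℕ) (fun _ => P) (poissonMeasure (Real.toNNReal (Real.exp (-y))))) ∧
    (∀ y : ℝ, Tendsto
      (fun n : ℕ => P.real {ω | (n : ℝ) * maxNNBallProb μ (fun i : Fin n => X i ω)
        - Real.log n ≤ y})
      atTop (𝓝 (Real.exp (-Real.exp (-y))))) := by
  have : Nontrivial (EuclideanSpace ℝ (Fin d)) := by
    have : Nonempty (Fin d) := ⟨⟨0, hd⟩⟩
    infer_instance
  have hsphere : ∀ x r, μ (Metric.sphere x r) = 0 := fun x r => by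
    rw [hμ]
    exact withDensity_absolutelyContinuous _ _ (Measure.addHaar_sphere _ x r)
  have hlaw : ∀ n : ℕ, HasLaw (fun ω (i : Fin n) => X i ω) (Measure.pi fun _ => μ) P := fun n =>
    (hX_indep.precomp Fin.val_injective).hasLaw_pi fun i => hX_law i
  have hpoint : ∀ (y : ℝ) (m : ℕ), Tendsto
      (fun n : ℕ => P.real {ω | nnExceedances μ y (fun i : Fin n => X i ω) = m}) atTop
      (𝓝 (Real.exp (-Real.exp (-y)) * Real.exp (-y) ^ m / m.factorial)) := by
    intro y m
    refine (tendsto_measureReal_eq_of_binomial_moments (fun n => Measure.pi fun _ : Fin n => μ)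
      (fun n x => nnExceedances μ y x) (fun n => measurable_nnExceedances)
      (fun n x => nnExceedances_le x) (fun k => tendsto_integral_choose_nnExceedances hsphere hβ1
        (le_max_right cmax 0) hδ
        (fun t ht0 ht1 htδ => ballCondition_of_forall hsphere hcond ht0 ht1 htδ) y k) m).congr
      fun n => ?_
    exact congrArg ENNReal.toReal ((hlaw n).measure_eq
      (measurable_nnExceedances (measurableSet_singleton m))).symm
  refine ⟨fun y => ?_, fun y => ?_⟩
  · have hae : ∀ n : ℕ, AEMeasurable (fun ω => nnExceedances μ y (fun i : Fin n => X i ω)) P :=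
      fun n => measurable_nnExceedances.comp_aemeasurable (hlaw n).aemeasurable
    refine ⟨hae, measurable_id.aemeasurable, tendsto_probabilityMeasure_nat fun m => ?_⟩
    simp only [ProbabilityMeasure.coe_mk, Measure.map_id]
    rw [poissonMeasure_real_singleton, Real.coe_toNNReal _ (Real.exp_pos _).le]
    refine (hpoint y m).congr fun n => ?_
    rw [measureReal_def, measureReal_def, Measure.map_apply_of_aemeasurable (hae n)
      (measurableSet_singleton m)]
    rfl
  · have h := hpoint y 0
    rw [pow_zero, mul_one, Nat.factorial_zero, Nat.cast_one, div_one] at h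
    refine h.congr' ?_
    filter_upwards [eventually_ne_atTop 0] with n hn
    simp only [nnExceedances_eq_zero_iff hn]
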